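/- Let $\mathbb T^2=\mathbb R^2/\mathbb Z^2$ with coordinates $(q,p)$. For a positive integer $N$ let $\mathcal H_N\cong\mathbb C^N$ carry its standard Hermitian inner product and its position basis $\mathbf q_0,\dots,\mathbf q_{N-1}$ (indices read modulo $N$). For $k=(k_1,k_2)\in\mathbb Z^2$ let $T(k)$ be the quantum translation on $\mathcal H_N$, $$T(k)\,\mathbf q_j=e^{-\pi i k_1k_2/N}\,e^{2\pi i k_2(j+k_1)/N}\,\mathbf q_{j+k_1},$$ and for $a\in C^\infty(\mathbb T^2)$ with Fourier expansion $a(q,p)=\sum_{k\in\mathbb Z^2}\tilde a(k)\,e^{2\pi i(qk_2-pk_1)}$ let $\mathrm{Op}^{\rm W}_N(a)=\sum_{k\in\mathbb Z^2}\tilde a(k)\,T(k)$ be its Weyl quantisation. For $N$ even, the Balazs–Voros quantised baker's map is the unitary matrix $$\hat B_N=\hat F_N^{-1}\begin{pmatrix}\hat F_{N/2}&0\\0&\hat F_{N/2}\end{pmatrix},\qquad (\hat F_M)_{kj}=\frac1{\sqrt M}\,e^{-2\pi i kj/M}\quad(0\le k,j<M).$$ For an orthonormal basis $\varphi=(\varphi_{N,j})_{0\le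 j<N}$ of $\mathcal H_N$ consisting of eigenvectors of $\hat B_N$, the quantum variance is $$S_2(a,N)=\frac1N\sum_{j=0}^{N-1}\Big|\langle\varphi_{N,j},\mathrm{Op}^{\rm W}_N(a)\,\varphi_{N,j}\rangle-\int_{\mathbb T^2}a\,dq\,dp\Big|^2 .$$ **Theorem.** For every (complex-valued) $a\in C^\infty(\mathbb T^2)$ the series defining $\mathrm{Op}^{\rm W}_N(a)$ converges absolutely for every $N$, and there is a constant $C(a)$, depending only on $a$, such that for every even positive integer $N$ and every orthonormal eigenbasis of $\hat B_N$, $$S_2(a,N)\le\frac{C(a)}{\log N}.$$ -/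

import Mathlib

open scoped ContDiff

noncomputable section

namespace BakerMap

/-- The state space `H_N`, in the canonical position basis `q_0, …, q_{N-1}`: the vector `ψ` stands
for the periodic distribution `N^{-1/2} ∑_{j ∈ ℤ} ψ_{j mod N} δ(q - j/N)`. -/
abbrev StateSpace (N : ℕ) : Type := EuclideanSpace ℂ (Fin N)

/-- The operator on `H_N` with a given matrix in the position basis. -/
abbrev op {N : ℕ} (A : Matrix (Fin N) (Fin N) ℂ) : StateSpace N →ₗ[ℂ] StateSpace N :=
  Matrix.toEuclideanLin A

/-- The entry `N^{-1/2} e^{-2πi kj/N}` of the discrete Fourier transform. -/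
def dftEntry (N k j : ℕ) : ℂ :=
  (1 / (Real.sqrt N : ℂ)) * Complex.exp (-2 * Real.pi * Complex.I * k * j / N)

/-- The discrete Fourier transform `F_N`, an `N × N` matrix. -/
def dft (N : ℕ) : Matrix (Fin N) (Fin N) ℂ :=
  Matrix.of fun k j => dftEntry N k j

/-- The block diagonal matrix `diag (F_{N/2}, F_{N/2})` (for even `N`). -/
def bakerMix (N : ℕ) : Matrix (Fin N) (Fin N) ℂ :=
  Matrix.of fun k j =>
    if (k : ℕ) < N / 2 ∧ (j : ℕ) < N / 2 then dftEntry (N / 2) k j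
    else if N / 2 ≤ (k : ℕ) ∧ N / 2 ≤ (j : ℕ) then dftEntry (N / 2) ((k : ℕ) - N / 2) ((j : ℕ) - N / 2)
    else 0

/-- The Balazs–Voros quantised baker's map `B_N = F_N⁻¹ diag (F_{N/2}, F_{N/2})` (for even `N`). -/
def quantumBaker (N : ℕ) : Matrix (Fin N) (Fin N) ℂ :=
  (dft N)⁻¹ * bakerMix N

/-- The matrix on `H_N` of the quantum translation `T(k) = e^{2πi (k₂ q̂ - k₁ p̂)}`, where
`q̂` is multiplication by `q` and `p̂ = (2πi N)⁻¹ d/dq`. As an operator on distributions,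
`(T(k) ψ)(q) = e^{-πi k₁ k₂ / N} e^{2πi k₂ q} ψ(q - k₁/N)`, so that on coefficients
`(T(k) ψ)_i = e^{-πi k₁ k₂ / N} e^{2πi k₂ i / N} ψ_{i - k₁ mod N}`. -/
def translation (N : ℕ) (k : ℤ × ℤ) : Matrix (Fin N) (Fin N) ℂ :=
  Matrix.of fun i j =>
    if ((i : ℕ) : ℤ) ≡ ((j : ℕ) : ℤ) + k.1 [ZMOD (N : ℤ)] then
      Complex.exp (-(Real.pi * Complex.I * k.1 * k.2 / N)) *
        Complex.exp (2 * Real.pi * Complex.I * k.2 * (i : ℕ) / N)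
    else 0

/-- `a : ℝ² → ℂ`, in the variables `(q, p)`, is a smooth function on the torus `ℝ²/ℤ²`. -/
structure IsSmoothObservable (a : ℝ × ℝ → ℂ) : Prop where
  contDiff : ContDiff ℝ ∞ a
  periodic_q : ∀ q p : ℝ, a (q + 1, p) = a (q, p)
  periodic_p : ∀ q p : ℝ, a (q, p + 1) = a (q, p)

/-- The mean of `a` over the torus. -/
def torusMean (a : ℝ × ℝ → ℂ) : ℂ :=
  ∫ q in (0 : ℝ)..1, ∫ p in (0 : ℝ)..1, a (q, p)

/-- The Fourier coefficient of `a` along `e_k(q, p) = e^{2πi (q k₂ - p k₁)}`. -/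
def fourierCoefficient (a : ℝ × ℝ → ℂ) (k : ℤ × ℤ) : ℂ :=
  torusMean fun x =>
    a x * Complex.exp (-(2 * Real.pi * Complex.I * (x.1 * k.2 - x.2 * k.1)))

/-- The Weyl quantisation `∑_{k ∈ ℤ²} ã(k) T(k)`, as a matrix in the position basis. -/
def weyl (N : ℕ) (a : ℝ × ℝ → ℂ) : Matrix (Fin N) (Fin N) ℂ :=
  ∑' k : ℤ × ℤ, fourierCoefficient a k • translation N k

/-- `φ` is an orthonormal basis of `H_N` that consists of eigenvectors of `B_N`. -/
def IsBakerEigenbasis {N : ℕ} (φ : OrthonormalBasis (Fin N) ℂ (StateSpace N)) : Prop :=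
  ∀ j, ∃ μ : ℂ, op (quantumBaker N) (φ j) = μ • φ j

/-- The quantum variance `S₂(a, N)` over the orthonormal basis `φ`. -/
def quantumVariance {N : ℕ} (φ : OrthonormalBasis (Fin N) ℂ (StateSpace N))
    (a : ℝ × ℝ → ℂ) : ℝ :=
  (1 / (N : ℝ)) * ∑ j : Fin N, ‖inner ℂ (φ j) (op (weyl N a) (φ j)) - torusMean a‖ ^ 2

end BakerMap

end

/-!
Time evolution by `B` does not change the expectation values in eigenstates of `B`, so an
observable may be replaced by its time average over `T` steps, and the quantum variance is at most
the squared normalised Hilbert–Schmidt norm of this average. For a translation `T(k)`, `k ≠ 0`,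
expanding the square leaves the autocorrelations `tr (T(k)* B⁻ʳ T(k) Bʳ)`, so the variance is
`O(1 / T)` once these decay.

The entries of `B` concentrate on the graph of the doubling map, which gives an Egorov theorem in
the Hilbert–Schmidt norm with an error `O(N^{1/4})` against the norm `N^{1/2}` of a unitary. The
error doubles with each step, so the theorem holds up to a time `T` comparable to `log N`. A
function of position becomes a faster oscillating function of position, orthogonal to the original
one. A function of momentum becomes, on each half of the positions, a function of momentum with
half the Lipschitz constant, so its off-diagonal part in the position basis decays exponentially,
while `T(k)` with `k₁ ≠ 0` is purely off-diagonal.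
-/

noncomputable section

open Matrix Finset
open scoped ComplexConjugate FourierTransform Matrix.Norms.Frobenius NNReal

namespace BakerMap

section HilbertSchmidt

variable {m n 𝕜 : Type*} [Fintype m] [Fintype n] [RCLike 𝕜]

lemma frobenius_norm_sq (A : Matrix m n 𝕜) : ‖A‖ ^ 2 = ∑ i, ∑ j, ‖A i j‖ ^ 2 := by
  rw [frobenius_norm_def, ← Real.rpow_natCast, ← Real.rpow_mul (by positivity)]
  norm_num

lemma frobenius_norm_le_of_sum_sq_le {A : Matrix m n 𝕜} {c : ℝ} (hc : 0 ≤ c)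
    (h : ∑ i, ∑ j, ‖A i j‖ ^ 2 ≤ c ^ 2) : ‖A‖ ≤ c :=
  (sq_le_sq₀ (norm_nonneg A) hc).1 ((frobenius_norm_sq A).trans_le h)

lemma trace_conjTranspose_mul_eq_sum (A B : Matrix m n 𝕜) :
    (Aᴴ * B).trace = ∑ i, ∑ j, conj (A i j) * B i j := by
  simp only [trace, diag_apply, mul_apply, conjTranspose_apply, RCLike.star_def]
  exact sum_comm

lemma inner_toLp_vec (A B : Matrix m n 𝕜) :
    inner 𝕜 (WithLp.toLp 2 (vec A)) (WithLp.toLp 2 (vec B)) = (Aᴴ * B).trace := by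
  rw [EuclideanSpace.inner_toLp_toLp, dotProduct_comm, star_vec_dotProduct_vec]

lemma norm_toLp_vec (A : Matrix m n 𝕜) : ‖WithLp.toLp 2 (vec A)‖ = ‖A‖ := by
  rw [← sq_eq_sq₀ (norm_nonneg _) (norm_nonneg _), frobenius_norm_sq,
    EuclideanSpace.norm_sq_eq, Fintype.sum_prod_type, sum_comm]
  rfl

lemma norm_trace_conjTranspose_mul_le (A B : Matrix m n 𝕜) :
    ‖(Aᴴ * B).trace‖ ≤ ‖A‖ * ‖B‖ := by
  rw [← inner_toLp_vec, ← norm_toLp_vec, ← norm_toLp_vec]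
  exact norm_inner_le_norm _ _

lemma frobenius_norm_sq_eq_trace (A : Matrix m n 𝕜) : ((‖A‖ ^ 2 : ℝ) : 𝕜) = (Aᴴ * A).trace := by
  rw [← inner_toLp_vec, inner_self_eq_norm_sq_to_K, norm_toLp_vec, RCLike.ofReal_pow]

lemma frobenius_norm_unitary_mul [DecidableEq m] {U : Matrix m m 𝕜} (hU : U ∈ unitaryGroup m 𝕜)
    (A : Matrix m n 𝕜) : ‖U * A‖ = ‖A‖ := by
  rw [← sq_eq_sq₀ (norm_nonneg _) (norm_nonneg _), ← RCLike.ofReal_inj (K := 𝕜),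
    frobenius_norm_sq_eq_trace, frobenius_norm_sq_eq_trace, conjTranspose_mul, Matrix.mul_assoc,
    ← Matrix.mul_assoc Uᴴ, ← star_eq_conjTranspose U, mem_unitaryGroup_iff'.1 hU, Matrix.one_mul]

lemma frobenius_norm_mul_unitary [DecidableEq n] {U : Matrix n n 𝕜} (hU : U ∈ unitaryGroup n 𝕜)
    (A : Matrix m n 𝕜) : ‖A * U‖ = ‖A‖ := by
  rw [← frobenius_norm_conjTranspose, conjTranspose_mul,
    ← star_eq_conjTranspose U,
    frobenius_norm_unitary_mul (Unitary.star_mem hU), frobenius_norm_conjTranspose]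

lemma frobenius_norm_diagonal_mul_le [DecidableEq m] {u : m → 𝕜} {c : ℝ} (hc : 0 ≤ c)
    (hu : ∀ i, ‖u i‖ ≤ c) (A : Matrix m n 𝕜) : ‖diagonal u * A‖ ≤ c * ‖A‖ := by
  refine frobenius_norm_le_of_sum_sq_le (by positivity) ?_
  simp only [mul_pow, frobenius_norm_sq A, mul_sum, diagonal_mul, norm_mul]
  gcongr
  exact hu _

lemma frobenius_norm_mul_diagonal_le [DecidableEq n] {u : n → 𝕜} {c : ℝ} (hc : 0 ≤ c)
    (hu : ∀ i, ‖u i‖ ≤ c) (A : Matrix m n 𝕜) : ‖A * diagonal u‖ ≤ c * ‖A‖ := by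
  rw [← frobenius_norm_conjTranspose, conjTranspose_mul, diagonal_conjTranspose,
    ← frobenius_norm_conjTranspose A]
  exact frobenius_norm_diagonal_mul_le hc (fun i => by simpa using hu i) _

lemma frobenius_norm_diagonal_le [DecidableEq n] {u : n → 𝕜} {c : ℝ} (hc : 0 ≤ c)
    (hu : ∀ i, ‖u i‖ ≤ c) : ‖diagonal u‖ ≤ c * √(Fintype.card n) := by
  have h_one : ‖(1 : Matrix n n 𝕜)‖ = √(Fintype.card n) := by
    rw [← diagonal_one, frobenius_norm_diagonal, EuclideanSpace.norm_eq]
    simp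
  simpa [h_one] using frobenius_norm_diagonal_mul_le hc hu (1 : Matrix n n 𝕜)

end HilbertSchmidt

section OffDiagonal

variable {n 𝕜 : Type*} [DecidableEq n] [RCLike 𝕜]

/-- The off-diagonal part of a matrix. Its Hilbert–Schmidt norm is the distance from the matrix to
the diagonal matrices. -/
def offDiag (A : Matrix n n 𝕜) : Matrix n n 𝕜 := A - diagonal A.diag

lemma offDiag_apply (A : Matrix n n 𝕜) (i j : n) :
    offDiag A i j = if i = j then 0 else A i j := by
  rcases eq_or_ne i j with rfl | h <;> simp [offDiag, *]

lemma offDiag_add (A B : Matrix n n 𝕜) : offDiag (A + B) = offDiag A + offDiag B := by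
  ext i j
  simp only [offDiag_apply, Matrix.add_apply]
  split_ifs <;> simp

lemma offDiag_diagonal (u : n → 𝕜) : offDiag (diagonal u) = 0 := by
  simp [offDiag]

variable [Fintype n]

lemma offDiag_diagonal_mul (u : n → 𝕜) (A : Matrix n n 𝕜) :
    offDiag (diagonal u * A) = diagonal u * offDiag A := by
  ext i j
  simp [offDiag_apply]

lemma norm_offDiag_le (A : Matrix n n 𝕜) : ‖offDiag A‖ ≤ ‖A‖ := by
  refine frobenius_norm_le_of_sum_sq_le (norm_nonneg A) ?_
  rw [frobenius_norm_sq]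
  gcongr
  rw [offDiag_apply]
  split_ifs <;> simp

lemma norm_offDiag_le_add (A B : Matrix n n 𝕜) : ‖offDiag A‖ ≤ ‖offDiag B‖ + ‖A - B‖ :=
  calc ‖offDiag A‖ = ‖offDiag B + offDiag (A - B)‖ := by rw [← offDiag_add, add_sub_cancel]
    _ ≤ ‖offDiag B‖ + ‖offDiag (A - B)‖ := norm_add_le _ _
    _ ≤ ‖offDiag B‖ + ‖A - B‖ := by gcongr; exact norm_offDiag_le _

lemma norm_offDiag_diagonal_mul_le {u : n → 𝕜} {c : ℝ} (hc : 0 ≤ c) (hu : ∀ i, ‖u i‖ ≤ c)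
    (A : Matrix n n 𝕜) : ‖offDiag (diagonal u * A)‖ ≤ c * ‖offDiag A‖ := by
  rw [offDiag_diagonal_mul]
  exact frobenius_norm_diagonal_mul_le hc hu _

lemma norm_offDiag_indicator_add_le (s : Set n) {A B : Matrix n n 𝕜} {c : ℝ}
    (hA : ‖offDiag A‖ ≤ c) (hB : ‖offDiag B‖ ≤ c) :
    ‖offDiag (diagonal (s.indicator 1) * A + diagonal (sᶜ.indicator 1) * B)‖ ≤ √2 * c := by
  have hc : 0 ≤ c := (norm_nonneg _).trans hA
  refine frobenius_norm_le_of_sum_sq_le (by positivity) ?_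
  calc _ ≤ ‖offDiag A‖ ^ 2 + ‖offDiag B‖ ^ 2 := by
        simp only [frobenius_norm_sq, ← sum_add_distrib]
        gcongr with i _ j _
        by_cases hi : i ∈ s <;> simp [offDiag_add, offDiag_diagonal_mul, hi]
    _ ≤ c ^ 2 + c ^ 2 := by gcongr
    _ = (√2 * c) ^ 2 := by rw [mul_pow, Real.sq_sqrt zero_le_two]; ring

lemma norm_trace_conjTranspose_mul_le_offDiag {A : Matrix n n 𝕜} (hA : A.diag = 0)
    (B : Matrix n n 𝕜) : ‖(Aᴴ * B).trace‖ ≤ ‖A‖ * ‖offDiag B‖ := by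
  have h_trace : (Aᴴ * B).trace = (Aᴴ * offDiag B).trace := by
    simp only [trace_conjTranspose_mul_eq_sum, offDiag_apply]
    refine sum_congr rfl fun i _ => sum_congr rfl fun j _ => ?_
    split_ifs with h
    · subst h
      simp [show A i i = 0 from congrFun hA i]
    · rfl
  exact h_trace ▸ norm_trace_conjTranspose_mul_le _ _

end OffDiagonal

section Character

lemma fourierChar_intCast (k : ℤ) : 𝐞 k = 1 := by
  rw [Real.fourierChar_apply', Circle.exp_two_pi_mul_int]

lemma fourierChar_add_intCast (x : ℝ) (k : ℤ) : 𝐞 (x + k) = 𝐞 x := by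
  rw [AddChar.map_add_eq_mul, fourierChar_intCast, mul_one]

lemma fourierChar_natCast_mul (n : ℕ) (x : ℝ) : 𝐞 (n * x) = 𝐞 x ^ n := by
  rw [← nsmul_eq_mul, AddChar.map_nsmul_eq_pow]

lemma fourierChar_eq_one_iff {x : ℝ} : 𝐞 x = 1 ↔ ∃ k : ℤ, x = k := by
  rw [Real.fourierChar_apply', Circle.exp_eq_one]
  refine exists_congr fun k => ?_
  rw [mul_comm, mul_left_inj' Real.two_pi_pos.ne']

lemma conj_fourierChar (x : ℝ) : conj (𝐞 x : ℂ) = 𝐞 (-x) := by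
  rw [AddChar.map_neg_eq_inv, Circle.coe_inv_eq_conj]

lemma norm_fourierChar_sub_one (x : ℝ) : ‖(𝐞 x : ℂ) - 1‖ = 2 * |Real.sin (Real.pi * x)| := by
  rw [Real.fourierChar_apply, mul_comm, Complex.norm_exp_I_mul_ofReal_sub_one, norm_mul,
    Real.norm_ofNat, Real.norm_eq_abs]
  ring_nf

lemma norm_fourierChar_sub_le (x y : ℝ) : ‖(𝐞 x : ℂ) - 𝐞 y‖ ≤ 2 * Real.pi * |x - y| := by
  have h_factor : (𝐞 x : ℂ) - 𝐞 y = 𝐞 y * (𝐞 (x - y) - 1) := by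
    rw [mul_sub, ← Circle.coe_mul, ← AddChar.map_add_eq_mul, add_sub_cancel, mul_one]
  rw [h_factor, norm_mul, Circle.norm_coe, one_mul, norm_fourierChar_sub_one, mul_assoc]
  gcongr
  simpa [abs_mul, abs_of_pos Real.pi_pos] using Real.abs_sin_le_abs (x := Real.pi * (x - y))

lemma min_le_norm_fourierChar_sub_one {x : ℝ} (h0 : 0 ≤ x) (h1 : x ≤ 1) :
    4 * min x (1 - x) ≤ ‖(𝐞 x : ℂ) - 1‖ := by
  have two_mul_le_sin {y : ℝ} (hy : 0 ≤ y) (hy' : y ≤ 1 / 2) :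
      2 * y ≤ Real.sin (Real.pi * y) := by
    have h := Real.mul_le_sin (x := Real.pi * y) (by positivity) (by nlinarith [Real.pi_pos])
    rwa [div_mul_eq_mul_div, mul_div_assoc, mul_div_cancel_left₀ _ Real.pi_ne_zero] at h
  rw [norm_fourierChar_sub_one]
  rcases le_total x (1 / 2) with h | h
  · linarith [two_mul_le_sin h0 h, le_abs_self (Real.sin (Real.pi * x)), min_le_left x (1 - x)]
  · have h_sin := two_mul_le_sin (y := 1 - x) (by linarith) (by linarith)
    rw [show Real.pi * (1 - x) = Real.pi - Real.pi * x by ring, Real.sin_pi_sub] at h_sin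
    linarith [le_abs_self (Real.sin (Real.pi * x)), min_le_right x (1 - x)]

lemma sum_fourierChar_mul_div {N : ℕ} (hN : 0 < N) (c : ℤ) :
    ∑ m : Fin N, (𝐞 (m * (c / N)) : ℂ) = if (N : ℤ) ∣ c then (N : ℂ) else 0 := by
  have hN' : (N : ℝ) ≠ 0 := by positivity
  have h_one_iff : 𝐞 (c / N) = 1 ↔ (N : ℤ) ∣ c := by
    simp only [fourierChar_eq_one_iff, div_eq_iff hN', dvd_def, mul_comm (N : ℤ)]
    exact exists_congr fun k => by exact_mod_cast Iff.rfl
  simp only [fourierChar_natCast_mul, Circle.coe_pow]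
  rw [Fin.sum_univ_eq_sum_range (fun m => (𝐞 (c / N) : ℂ) ^ m)]
  split_ifs with h
  · simp [h_one_iff.2 h]
  · have h_ne : (𝐞 (c / N) : ℂ) ≠ 1 := by
      simpa only [ne_eq, Circle.coe_eq_one] using mt h_one_iff.1 h
    rw [geom_sum_eq h_ne, ← Circle.coe_pow, ← fourierChar_natCast_mul, mul_div_cancel₀ _ hN',
      fourierChar_intCast]
    simp

lemma norm_sum_fourierChar_mul_le (M : ℕ) (x : ℝ) :
    ‖∑ j : Fin M, (𝐞 (j * x) : ℂ)‖ * ‖(𝐞 x : ℂ) - 1‖ ≤ 2 := by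
  simp only [fourierChar_natCast_mul, Circle.coe_pow]
  rw [Fin.sum_univ_eq_sum_range (fun m => (𝐞 x : ℂ) ^ m), ← norm_mul, geom_sum_mul]
  refine (norm_sub_le _ _).trans ?_
  rw [norm_pow, Circle.norm_coe]
  norm_num

end Character

section FourierTransform

lemma dftEntry_eq (N k j : ℕ) : dftEntry N k j = (√N)⁻¹ * 𝐞 (-(k * (j / N))) := by
  rw [dftEntry, one_div, Real.fourierChar_apply]
  push_cast
  ring_nf

lemma dft_apply (N : ℕ) (k j : Fin N) : dft N k j = (√N)⁻¹ * 𝐞 (-(k * (j / N) : ℝ)) :=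
  dftEntry_eq N k j

lemma dft_conjTranspose_mul_diagonal_mul_apply (N : ℕ) (u : Fin N → ℂ) (i j : Fin N) :
    ((dft N)ᴴ * diagonal u * dft N) i j =
      (N : ℂ)⁻¹ * ∑ m : Fin N, u m * 𝐞 (m * (((i : ℝ) - j) / N)) := by
  rw [mul_apply, mul_sum]
  refine sum_congr rfl fun m _ => ?_
  have h_sqrt : (((√N)⁻¹ : ℝ) : ℂ) * ((√N)⁻¹ : ℝ) = (N : ℂ)⁻¹ := by
    rw [← Complex.ofReal_mul, ← mul_inv, Real.mul_self_sqrt N.cast_nonneg, Complex.ofReal_inv,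
      Complex.ofReal_natCast]
  have h_char : (𝐞 (m * (((i : ℝ) - j) / N)) : ℂ) = 𝐞 (m * (i / N)) * 𝐞 (-(m * (j / N))) := by
    rw [← Circle.coe_mul, ← AddChar.map_add_eq_mul]
    ring_nf
  rw [mul_diagonal, conjTranspose_apply, dft_apply, dft_apply, RCLike.star_def, map_mul,
    conj_fourierChar, neg_neg, Complex.conj_ofReal, h_char, ← h_sqrt]
  ring

lemma dft_mem_unitaryGroup {N : ℕ} (hN : 0 < N) : dft N ∈ unitaryGroup (Fin N) ℂ := by
  rw [mem_unitaryGroup_iff', star_eq_conjTranspose]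
  ext i j
  have h := dft_conjTranspose_mul_diagonal_mul_apply N (fun _ => 1) i j
  have h_sum := sum_fourierChar_mul_div hN (i - j)
  have h_dvd : (N : ℤ) ∣ (i : ℤ) - j ↔ i = j := by
    refine ⟨fun hd => Fin.ext ?_, fun h => by simp [h]⟩
    have := Int.eq_zero_of_abs_lt_dvd hd (abs_lt.2 (by omega))
    omega
  rw [diagonal_one, Matrix.mul_one] at h
  push_cast at h_sum
  simp only [h, one_mul, h_sum, h_dvd, one_apply, mul_ite, mul_zero,
    inv_mul_cancel₀ (Nat.cast_ne_zero.2 hN.ne' : (N : ℂ) ≠ 0)]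

lemma dft_transpose (N : ℕ) : (dft N)ᵀ = dft N := by
  ext i j
  rw [transpose_apply, dft_apply, dft_apply]
  ring_nf

end FourierTransform

section QuantumBaker

variable {M : ℕ}

lemma bakerMix_eq_submatrix_fromBlocks (M : ℕ) : bakerMix (M + M) =
    (fromBlocks (dft M) 0 0 (dft M)).submatrix finSumFinEquiv.symm finSumFinEquiv.symm := by
  have h_half : (M + M) / 2 = M := by omega
  ext i j
  obtain ⟨i | i, rfl⟩ := finSumFinEquiv.surjective i <;>
    obtain ⟨j | j, rfl⟩ := finSumFinEquiv.surjective j <;>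
    simp [bakerMix, dft, h_half, -Fin.natAdd_eq_addNat]

lemma bakerMix_mem_unitaryGroup (hM : 0 < M) :
    bakerMix (M + M) ∈ unitaryGroup (Fin (M + M)) ℂ := by
  have h_dft := mem_unitaryGroup_iff'.1 (dft_mem_unitaryGroup hM)
  rw [star_eq_conjTranspose] at h_dft
  rw [mem_unitaryGroup_iff', star_eq_conjTranspose, bakerMix_eq_submatrix_fromBlocks,
    conjTranspose_submatrix, submatrix_mul_equiv, fromBlocks_conjTranspose, fromBlocks_multiply]
  simp [h_dft]

lemma bakerMix_transpose (M : ℕ) : (bakerMix (M + M))ᵀ = bakerMix (M + M) := by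
  rw [bakerMix_eq_submatrix_fromBlocks, transpose_submatrix, fromBlocks_transpose, dft_transpose,
    transpose_zero]

lemma quantumBaker_eq {N : ℕ} (hN : 0 < N) : quantumBaker N = (dft N)ᴴ * bakerMix N := by
  rw [quantumBaker, inv_eq_left_inv (mem_unitaryGroup_iff'.1 (dft_mem_unitaryGroup hN)),
    star_eq_conjTranspose]

lemma quantumBaker_mem_unitaryGroup (hM : 0 < M) :
    quantumBaker (M + M) ∈ unitaryGroup (Fin (M + M)) ℂ := by
  rw [quantumBaker_eq (by omega)]
  exact mul_mem (Unitary.star_mem (dft_mem_unitaryGroup (by omega))) (bakerMix_mem_unitaryGroup hM)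

lemma dft_mul_bakerMix_conjTranspose (hM : 0 < M) (i j : Fin (M + M)) :
    (dft (M + M) * (bakerMix (M + M))ᴴ) i j = conj (quantumBaker (M + M) i j) := by
  simp only [quantumBaker_eq (Nat.add_pos_left hM M), mul_apply, map_sum, map_mul,
    conjTranspose_apply, RCLike.star_def, Complex.conj_conj]
  refine sum_congr rfl fun k _ => ?_
  rw [← transpose_apply (dft _), dft_transpose, ← transpose_apply (bakerMix _), bakerMix_transpose]

lemma conj_dftEntry_mul_dftEntry (hM : 0 < M) (d j : ℕ) {m l r : ℕ}
    (h : m ≡ r + 2 * l [MOD M + M]) :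
    conj (dftEntry (M + M) (d + j) m) * dftEntry M j l =
      (√2 * M : ℝ)⁻¹ * 𝐞 (d * (m / (M + M : ℕ))) * 𝐞 (j * (r / (M + M : ℕ))) := by
  have h_sqrt : √(M + M : ℕ) * √M = √2 * M := by
    rw [← two_mul, Nat.cast_mul, Nat.cast_ofNat, Real.sqrt_mul zero_le_two, mul_assoc,
      Real.mul_self_sqrt M.cast_nonneg]
  obtain ⟨k, hk⟩ := Nat.modEq_iff_dvd.1 h
  have hr : (r : ℝ) = m + (M + M) * k - 2 * l := by
    have : ((r + 2 * l : ℕ) - m : ℝ) = (M + M : ℕ) * k := by exact_mod_cast hk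
    push_cast at this
    linarith
  have h_char : 𝐞 ((d + j : ℕ) * (m / (M + M : ℕ))) * 𝐞 (-(j * (l / M))) =
      𝐞 (d * (m / (M + M : ℕ))) * 𝐞 (j * (r / (M + M : ℕ))) := by
    rw [← AddChar.map_add_eq_mul, ← AddChar.map_add_eq_mul,
      ← fourierChar_add_intCast _ (j * k), hr]
    congr 1
    push_cast
    field_simp
    ring
  have h_char' := congrArg ((↑) : Circle → ℂ) h_char
  rw [Circle.coe_mul, Circle.coe_mul] at h_char'
  rw [dftEntry_eq, dftEntry_eq, map_mul, conj_fourierChar, neg_neg, Complex.conj_ofReal, ← h_sqrt,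
    mul_inv, Complex.ofReal_mul]
  linear_combination (((√(M + M : ℕ))⁻¹ : ℝ) * ((√M)⁻¹ : ℝ) : ℂ) * h_char'

lemma norm_quantumBaker_apply [NeZero M] (m m' : Fin (M + M)) :
    ‖quantumBaker (M + M) m m'‖ = (√2 * M)⁻¹ *
      ‖∑ j : Fin M, (𝐞 (j * ((m - (m' + m') : Fin (M + M)) / (M + M : ℕ))) : ℂ)‖ := by
  have hM := NeZero.pos M
  set r := m - (m' + m') with hr
  have h_mod (l : ℕ) (hl : 2 * (m' : ℕ) ≡ 2 * l [MOD M + M]) :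
      (m : ℕ) ≡ r + 2 * l [MOD M + M] := by
    have h_val : (m : ℕ) ≡ r + 2 * m' [MOD M + M] := by
      rw [show m = r + (m' + m') by rw [hr]; abel]
      simp [Nat.ModEq, Fin.val_add, two_mul]
    exact h_val.trans (hl.add_left _)
  have h_block (l : Fin M) (d : ℕ) (hl : 2 * (m' : ℕ) ≡ 2 * l [MOD M + M]) :
      ‖∑ j : Fin M, conj (dftEntry (M + M) (d + j) m) * dftEntry M j l‖ =
        (√2 * M)⁻¹ * ‖∑ j : Fin M, (𝐞 (j * (r / (M + M : ℕ))) : ℂ)‖ := by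
    have h_pos : 0 ≤ (√2 * M)⁻¹ := by positivity
    simp only [conj_dftEntry_mul_dftEntry hM d _ (h_mod l hl), ← mul_sum, norm_mul,
      Circle.norm_coe, mul_one, Complex.norm_real, Real.norm_of_nonneg h_pos]
  rw [quantumBaker_eq (by omega), bakerMix_eq_submatrix_fromBlocks, mul_apply, Fin.sum_univ_add]
  induction m' using Fin.addCases with
  | left l => simpa [dft, -Fin.natAdd_eq_addNat] using h_block l 0 rfl
  | right l =>
    have hl : 2 * (Fin.natAdd M l : ℕ) ≡ 2 * l [MOD M + M] := by
      rw [Fin.val_natAdd, mul_add, two_mul M]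
      exact Nat.add_modEq_left
    simpa [dft, -Fin.natAdd_eq_addNat] using h_block l M hl

end QuantumBaker

section Variation

lemma sum_norm_nsmul_shift_sub_le {G E : Type*} [AddCommGroup G] [Fintype G]
    [SeminormedAddCommGroup E] (u : G → E) (g : G) (k : ℕ) :
    ∑ x, ‖u (x + k • g) - u x‖ ≤ k * ∑ x, ‖u (x + g) - u x‖ := by
  induction k with
  | zero => simp
  | succ k ih =>
    calc ∑ x, ‖u (x + (k + 1) • g) - u x‖
        ≤ ∑ x, (‖u (x + k • g + g) - u (x + k • g)‖ + ‖u (x + k • g) - u x‖) := by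
          gcongr with x
          rw [succ_nsmul, ← add_assoc]
          exact norm_sub_le_norm_sub_add_norm_sub _ _ _
      _ = ∑ x, ‖u (x + g) - u x‖ + ∑ x, ‖u (x + k • g) - u x‖ := by
          rw [sum_add_distrib]
          congr 1
          exact Equiv.sum_comp (Equiv.addRight (k • g)) fun y => ‖u (y + g) - u y‖
      _ ≤ (k + 1 : ℕ) * ∑ x, ‖u (x + g) - u x‖ := by push_cast; linarith

lemma sum_norm_neg_shift_sub {G E : Type*} [AddCommGroup G] [Fintype G]
    [SeminormedAddCommGroup E] (u : G → E) (g : G) :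
    ∑ x, ‖u (x + -g) - u x‖ = ∑ x, ‖u (x + g) - u x‖ := by
  rw [← Equiv.sum_comp (Equiv.addRight g)]
  simp [norm_sub_rev]

variable {N : ℕ}

/-- The distance from a residue class modulo `N` to `0`, on the circle of length `N`. -/
def cyclicDist (r : Fin N) : ℝ := min (r : ℝ) (N - r)

lemma cyclicDist_nonneg (r : Fin N) : 0 ≤ cyclicDist r :=
  le_min r.val.cast_nonneg (sub_nonneg.2 (by exact_mod_cast r.2.le))

variable [NeZero N]

/-- The total variation of a function on the cyclic group `ℤ/N`. -/
def cyclicVar (u : Fin N → ℂ) : ℝ := ∑ x, ‖u (x + 1) - u x‖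

lemma cyclicVar_nonneg (u : Fin N → ℂ) : 0 ≤ cyclicVar u := sum_nonneg fun _ _ => norm_nonneg _

lemma cyclicDist_zero : cyclicDist (0 : Fin N) = 0 := by simp [cyclicDist]

lemma cyclicDist_pos {r : Fin N} (hr : r ≠ 0) : 0 < cyclicDist r :=
  lt_min (by exact_mod_cast Fin.pos_iff_ne_zero.2 hr) (sub_pos.2 (by exact_mod_cast r.2))

open Fin.NatCast Fin.CommRing in
lemma val_nsmul_one (r : Fin N) : (r : ℕ) • (1 : Fin N) = r := by
  rw [nsmul_one, Fin.cast_val_eq_self]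

lemma sum_norm_shift_sub_le (u : Fin N → ℂ) (r : Fin N) :
    ∑ x, ‖u (x + r) - u x‖ ≤ cyclicDist r * cyclicVar u := by
  have h_val (r : Fin N) : ∑ x, ‖u (x + r) - u x‖ ≤ r * cyclicVar u := by
    simpa [val_nsmul_one, cyclicVar] using sum_norm_nsmul_shift_sub_le u 1 (r : ℕ)
  rcases eq_or_ne r 0 with rfl | hr
  · simp [cyclicDist_zero]
  rw [cyclicDist, min_mul_of_nonneg _ _ (cyclicVar_nonneg u)]
  refine le_min (h_val r) ?_
  simpa [sum_norm_neg_shift_sub, Fin.val_neg, hr, Nat.cast_sub r.2.le] using h_val (-r)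

lemma sum_inv_cyclicDist_le : ∑ r : Fin N, (cyclicDist r)⁻¹ ≤ 2 * (1 + Real.log N) := by
  have h_harmonic : ∑ i ∈ range N, ((i : ℝ) + 1)⁻¹ ≤ 1 + Real.log N := by
    simpa [harmonic] using harmonic_le_one_add_log N
  have h_right : ∑ r : Fin N, ((N : ℝ) - r)⁻¹ ≤ 1 + Real.log N := by
    refine le_of_eq_of_le ?_ h_harmonic
    rw [Fin.sum_univ_eq_sum_range (fun r : ℕ => ((N : ℝ) - r)⁻¹), ← sum_range_reflect]
    refine sum_congr rfl fun i hi => ?_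
    rw [mem_range] at hi
    rw [Nat.sub_sub, Nat.cast_sub (by omega)]
    push_cast
    ring_nf
  have h_left : ∑ r : Fin N, (r : ℝ)⁻¹ ≤ 1 + Real.log N := by
    refine le_trans ?_ h_harmonic
    obtain ⟨K, rfl⟩ := Nat.exists_eq_succ_of_ne_zero (NeZero.ne N)
    rw [Fin.sum_univ_eq_sum_range (fun r : ℕ => (r : ℝ)⁻¹), sum_range_succ', sum_range_succ]
    push_cast
    rw [_root_.inv_zero]
    gcongr
    positivity
  calc ∑ r : Fin N, (cyclicDist r)⁻¹ ≤ ∑ r : Fin N, ((r : ℝ)⁻¹ + ((N : ℝ) - r)⁻¹) := by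
        gcongr with r
        have hr : 0 ≤ ((N : ℝ) - r)⁻¹ := inv_nonneg.2 (sub_nonneg.2 (by exact_mod_cast r.2.le))
        have hr' : 0 ≤ (r : ℝ)⁻¹ := by positivity
        rcases min_choice (r : ℝ) (N - r) with h | h <;> rw [cyclicDist, h] <;> linarith
    _ ≤ 2 * (1 + Real.log N) := by rw [sum_add_distrib]; linarith

lemma cyclicDist_mul_le_norm_fourierChar_sub_one (r : Fin N) :
    4 * cyclicDist r / N ≤ ‖(𝐞 (r / N) : ℂ) - 1‖ := by
  have hN : (0 : ℝ) < N := Nat.cast_pos.2 (NeZero.pos N)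
  have hr : (r : ℝ) / N ≤ 1 := (div_le_one hN).2 (by exact_mod_cast r.2.le)
  convert min_le_norm_fourierChar_sub_one (by positivity) hr using 1
  rw [cyclicDist, mul_div_assoc, ← min_div_div_right hN.le, sub_div, div_self hN.ne']

end Variation

section Doubling

variable {M : ℕ}

lemma val_castAdd_add_self (l : Fin M) :
    ((Fin.castAdd M l + Fin.castAdd M l : Fin (M + M)) : ℕ) = 2 * l := by
  rw [Fin.val_add, Fin.val_castAdd, Nat.mod_eq_of_lt (by omega), two_mul]

lemma natAdd_add_self (l : Fin M) :
    (Fin.natAdd M l + Fin.natAdd M l : Fin (M + M)) = Fin.castAdd M l + Fin.castAdd M l := by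
  ext
  rw [val_castAdd_add_self, Fin.val_add, Fin.val_natAdd,
    show M + (l : ℕ) + (M + l) = 2 * l + (M + M) by omega, Nat.add_mod_right,
    Nat.mod_eq_of_lt (by omega)]

lemma sum_comp_double_le {f : Fin (M + M) → ℝ} (hf : 0 ≤ f) :
    ∑ x, f (x + x) ≤ 2 * ∑ x, f x := by
  rw [Fin.sum_univ_add]
  simp only [natAdd_add_self]
  rw [← two_mul]
  gcongr
  have h_inj : Function.Injective fun l : Fin M => Fin.castAdd M l + Fin.castAdd M l := by
    intro a b hab
    have h_val := congrArg Fin.val hab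
    simp only [val_castAdd_add_self] at h_val
    omega
  calc ∑ l : Fin M, f (Fin.castAdd M l + Fin.castAdd M l)
      = ∑ x ∈ univ.map ⟨_, h_inj⟩, f x := (sum_map univ ⟨_, h_inj⟩ f).symm
    _ ≤ ∑ x, f x := sum_le_univ_sum_of_nonneg hf

/-- Composition with the doubling map of `ℤ/N`, for even `N`: the classical baker's map acts in
this way on functions of the position. -/
def double (u : Fin (M + M) → ℂ) (x : Fin (M + M)) : ℂ := u (x + x)

lemma iterate_double_apply (u : Fin (M + M) → ℂ) (t : ℕ) (x : Fin (M + M)) :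
    double^[t] u x = u ((fun y => y + y)^[t] x) := by
  induction t generalizing x with
  | zero => rfl
  | succ t ih => rw [Function.iterate_succ_apply', Function.iterate_succ_apply, double, ih]

lemma iterate_double_indicator (s : Set (Fin (M + M))) (t : ℕ) :
    double^[t] (s.indicator 1) = ((fun y => y + y)^[t] ⁻¹' s).indicator 1 := by
  ext x
  rw [iterate_double_apply]
  rfl

variable [NeZero M]

lemma cyclicVar_double_le (u : Fin (M + M) → ℂ) : cyclicVar (double u) ≤ 4 * cyclicVar u := by
  have h_shift : ∑ x, ‖u (x + 1 + 1) - u (x + 1)‖ = cyclicVar u :=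
    Equiv.sum_comp (Equiv.addRight (1 : Fin (M + M))) fun y => ‖u (y + 1) - u y‖
  calc cyclicVar (double u)
      ≤ ∑ x, (‖u (x + x + 1 + 1) - u (x + x + 1)‖ + ‖u (x + x + 1) - u (x + x)‖) := by
        rw [cyclicVar]
        gcongr with x
        rw [double, double, show x + 1 + (x + 1) = x + x + 1 + 1 by abel]
        exact norm_sub_le_norm_sub_add_norm_sub _ _ _
    _ ≤ 2 * ∑ x, (‖u (x + 1 + 1) - u (x + 1)‖ + ‖u (x + 1) - u x‖) :=
        sum_comp_double_le (f := fun y => ‖u (y + 1 + 1) - u (y + 1)‖ + ‖u (y + 1) - u y‖)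
          fun y => by positivity
    _ = 4 * cyclicVar u := by rw [sum_add_distrib, h_shift, ← cyclicVar]; ring

lemma cyclicDist_mul_norm_quantumBaker_sq_le (m m' : Fin (M + M)) :
    2 * (cyclicDist (m - (m' + m')) * ‖quantumBaker (M + M) m m'‖) ^ 2 ≤ 1 := by
  set r := m - (m' + m')
  have hM : (0 : ℝ) < M := Nat.cast_pos.2 (NeZero.pos M)
  have hd := cyclicDist_nonneg r
  have h_geom : ‖quantumBaker (M + M) m m'‖ * ‖(𝐞 (r / (M + M : ℕ)) : ℂ) - 1‖ ≤
      (√2 * M)⁻¹ * 2 := by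
    rw [norm_quantumBaker_apply, mul_assoc]
    gcongr
    exact norm_sum_fourierChar_mul_le M _
  have h_bound : √2 * (cyclicDist r * ‖quantumBaker (M + M) m m'‖) ≤ 1 :=
    calc _ = √2 * M / 2 * (‖quantumBaker (M + M) m m'‖ * (4 * cyclicDist r / (M + M : ℕ))) := by
          push_cast; field_simp; ring
      _ ≤ √2 * M / 2 * ((√2 * M)⁻¹ * 2) := by
          refine mul_le_mul_of_nonneg_left (le_trans ?_ h_geom) (by positivity)
          gcongr
          exact cyclicDist_mul_le_norm_fourierChar_sub_one r
      _ = 1 := by field_simp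
  calc _ = (√2 * (cyclicDist r * ‖quantumBaker (M + M) m m'‖)) ^ 2 := by
        rw [mul_pow √2, Real.sq_sqrt zero_le_two]
    _ ≤ 1 := pow_le_one₀ (by positivity) h_bound

lemma norm_quantumBaker_sq_mul_sub_double_sq_le {u : Fin (M + M) → ℂ} (hu : ∀ x, ‖u x‖ ≤ 1)
    (m m' : Fin (M + M)) :
    ‖quantumBaker (M + M) m m'‖ ^ 2 * ‖u m - double u m'‖ ^ 2 ≤
      (cyclicDist (m - (m' + m')) ^ 2)⁻¹ * ‖u m - double u m'‖ := by
  rcases eq_or_ne (m - (m' + m')) 0 with h | h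
  · simp [double, sub_eq_zero.1 h]
  have hd := cyclicDist_pos h
  have h_two : ‖u m - double u m'‖ ≤ 2 :=
    (norm_sub_le _ _).trans ((add_le_add (hu m) (hu (m' + m'))).trans_eq one_add_one_eq_two)
  have h_entry : ‖quantumBaker (M + M) m m'‖ ^ 2 ≤ (2 * cyclicDist (m - (m' + m')) ^ 2)⁻¹ := by
    rw [← one_div, le_div_iff₀ (by positivity)]
    linarith [cyclicDist_mul_norm_quantumBaker_sq_le m m', mul_pow
      (cyclicDist (m - (m' + m'))) ‖quantumBaker (M + M) m m'‖ 2]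
  calc _ ≤ (2 * cyclicDist (m - (m' + m')) ^ 2)⁻¹ * (2 * ‖u m - double u m'‖) := by
        rw [sq ‖u m - _‖]
        gcongr
    _ = _ := by field_simp

lemma sum_norm_quantumBaker_sq_mul_sub_double_sq_le {u : Fin (M + M) → ℂ}
    (hu : ∀ x, ‖u x‖ ≤ 1) :
    ∑ m, ∑ m', ‖quantumBaker (M + M) m m'‖ ^ 2 * ‖u m - double u m'‖ ^ 2 ≤
      4 * (1 + Real.log (M + M : ℕ)) * cyclicVar u := by
  have h_var := cyclicVar_nonneg u
  have h_shift (r : Fin (M + M)) : (cyclicDist r ^ 2)⁻¹ * ∑ m, ‖u (m + m + r) - u (m + m)‖ ≤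
      2 * cyclicVar u * (cyclicDist r)⁻¹ := by
    calc _ ≤ (cyclicDist r ^ 2)⁻¹ * (2 * (cyclicDist r * cyclicVar u)) := by
          gcongr
          refine (sum_comp_double_le (f := fun y => ‖u (y + r) - u y‖)
            fun _ => norm_nonneg _).trans ?_
          gcongr
          exact sum_norm_shift_sub_le u r
      _ = _ := by
          rcases eq_or_ne r 0 with rfl | hr
          · simp [cyclicDist_zero]
          · have := (cyclicDist_pos hr).ne'
            field_simp
  calc _ ≤ ∑ m, ∑ m', (cyclicDist (m - (m' + m')) ^ 2)⁻¹ * ‖u m - double u m'‖ := by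
        exact sum_le_sum fun m _ => sum_le_sum fun m' _ =>
          norm_quantumBaker_sq_mul_sub_double_sq_le hu m m'
    _ = ∑ m', ∑ r, (cyclicDist r ^ 2)⁻¹ * ‖u (m' + m' + r) - u (m' + m')‖ := by
        rw [sum_comm]
        refine sum_congr rfl fun m' _ => ?_
        rw [← Equiv.sum_comp (Equiv.addLeft (m' + m'))]
        simp only [Equiv.coe_addLeft, double, add_sub_cancel_left]
    _ = ∑ r, (cyclicDist r ^ 2)⁻¹ * ∑ m, ‖u (m + m + r) - u (m + m)‖ := by
        rw [sum_comm]
        simp only [mul_sum]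
    _ ≤ ∑ r, 2 * cyclicVar u * (cyclicDist r)⁻¹ := sum_le_sum fun r _ => h_shift r
    _ ≤ 2 * cyclicVar u * (2 * (1 + Real.log (M + M : ℕ))) := by
        rw [← mul_sum]
        gcongr
        exact sum_inv_cyclicDist_le
    _ = _ := by ring

end Doubling

section Evolution

variable {n 𝕜 : Type*} [Fintype n] [DecidableEq n] [RCLike 𝕜] (U : unitaryGroup n 𝕜)

/-- The Heisenberg evolution `X ↦ U⁻ᵗ X Uᵗ` of observables up to time `t`. -/
def evolve (t : ℕ) : Matrix n n 𝕜 ≃⋆ₐ[𝕜] Matrix n n 𝕜 := Unitary.conjStarAlgAut 𝕜 _ (U⁻¹ ^ t)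

lemma evolve_zero (X : Matrix n n 𝕜) : evolve U 0 X = X := by simp [evolve]

lemma evolve_add (s t : ℕ) (X : Matrix n n 𝕜) :
    evolve U (s + t) X = evolve U s (evolve U t X) := by
  simp only [evolve, pow_add, Unitary.conjStarAlgAut_mul_apply]

lemma evolve_one_apply (X : Matrix n n 𝕜) :
    evolve U 1 X = (U : Matrix n n 𝕜)ᴴ * X * (U : Matrix n n 𝕜) := by
  rw [evolve, pow_one]
  exact Unitary.conjStarAlgAut_star_apply U X

lemma norm_evolve (t : ℕ) (X : Matrix n n 𝕜) : ‖evolve U t X‖ = ‖X‖ := by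
  rw [evolve, Unitary.conjStarAlgAut_apply,
    frobenius_norm_mul_unitary (Unitary.star_mem (SetLike.coe_mem _)),
    frobenius_norm_unitary_mul (SetLike.coe_mem _)]

end Evolution

section Egorov

/-- The bound for the Hilbert–Schmidt error in Egorov's theorem on `ℂᴺ`, for a function of total
variation `V` and one time step. The entrywise estimates bound its square by `4 V (1 + log N)`,
of which `16 V √N` is a convenient majorant. -/
def egorovError (N : ℕ) (V : ℝ) : ℝ := 4 * √V * √√N

lemma egorovError_nonneg (N : ℕ) (V : ℝ) : 0 ≤ egorovError N V := by
  unfold egorovError; positivity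

lemma egorovError_mono (N : ℕ) : Monotone (egorovError N) := fun _ _ h => by
  unfold egorovError; gcongr

lemma egorovError_four_mul (N : ℕ) (V : ℝ) : egorovError N (4 * V) = 2 * egorovError N V := by
  rw [egorovError, egorovError, Real.sqrt_mul zero_le_four, show (4 : ℝ) = 2 ^ 2 by norm_num,
    Real.sqrt_sq zero_le_two]
  ring

lemma egorovError_sq (N : ℕ) {V : ℝ} (hV : 0 ≤ V) : egorovError N V ^ 2 = 16 * V * √N := by
  rw [egorovError, mul_pow, mul_pow, Real.sq_sqrt hV, Real.sq_sqrt (Real.sqrt_nonneg _)]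
  ring

lemma four_mul_one_add_log_le {N : ℕ} (hN : 0 < N) : 4 * (1 + Real.log N) ≤ 16 * √N := by
  have h_one : 1 ≤ √(N : ℝ) := Real.one_le_sqrt.2 (by exact_mod_cast hN)
  have h_log := Real.log_le_self (Real.sqrt_nonneg N)
  rw [Real.log_sqrt (Nat.cast_nonneg N)] at h_log
  linarith

/-- The quantised baker's map on `ℂ²ᴹ`, as an element of the unitary group. -/
def baker (M : ℕ) [NeZero M] : unitaryGroup (Fin (M + M)) ℂ :=
  ⟨quantumBaker (M + M), quantumBaker_mem_unitaryGroup (NeZero.pos M)⟩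

variable {M : ℕ} [NeZero M]

lemma sum_norm_quantumBaker_sq_mul_sub_double_sq_le_egorovError {u : Fin (M + M) → ℂ}
    (hu : ∀ x, ‖u x‖ ≤ 1) :
    ∑ m, ∑ m', ‖quantumBaker (M + M) m m'‖ ^ 2 * ‖u m - double u m'‖ ^ 2 ≤
      egorovError (M + M) (cyclicVar u) ^ 2 := by
  rw [egorovError_sq _ (cyclicVar_nonneg u), mul_right_comm]
  exact (sum_norm_quantumBaker_sq_mul_sub_double_sq_le hu).trans <|
    mul_le_mul_of_nonneg_right (four_mul_one_add_log_le (NeZero.pos _)) (cyclicVar_nonneg u)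

lemma norm_evolve_diagonal_sub_le {u : Fin (M + M) → ℂ} (hu : ∀ x, ‖u x‖ ≤ 1) :
    ‖evolve (baker M) 1 (diagonal u) - diagonal (double u)‖ ≤
      egorovError (M + M) (cyclicVar u) := by
  set B := quantumBaker (M + M)
  have hB : B ∈ unitaryGroup _ ℂ := quantumBaker_mem_unitaryGroup (NeZero.pos M)
  have h_comm : evolve (baker M) 1 (diagonal u) - diagonal (double u) =
      Bᴴ * (diagonal u * B - B * diagonal (double u)) := by
    rw [evolve_one_apply, Matrix.mul_sub, ← Matrix.mul_assoc, ← Matrix.mul_assoc,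
      ← star_eq_conjTranspose B, mem_unitaryGroup_iff'.1 hB, Matrix.one_mul]
    rfl
  rw [h_comm, ← star_eq_conjTranspose B, frobenius_norm_unitary_mul (Unitary.star_mem hB)]
  refine frobenius_norm_le_of_sum_sq_le (egorovError_nonneg _ _)
    (le_of_eq_of_le ?_ (sum_norm_quantumBaker_sq_mul_sub_double_sq_le_egorovError hu))
  refine sum_congr rfl fun m _ => sum_congr rfl fun m' _ => ?_
  rw [Matrix.sub_apply, diagonal_mul, mul_diagonal, mul_comm (B m m'), ← sub_mul, norm_mul,
    mul_pow, mul_comm]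

lemma norm_bakerMix_conj_sub_dft_conj_le {u : Fin (M + M) → ℂ} (hu : ∀ x, ‖u x‖ ≤ 1) :
    ‖(bakerMix (M + M))ᴴ * diagonal (double u) * bakerMix (M + M) -
      (dft (M + M))ᴴ * diagonal u * dft (M + M)‖ ≤ egorovError (M + M) (cyclicVar u) := by
  have h_entry := dft_mul_bakerMix_conjTranspose (NeZero.pos M)
  set F := dft (M + M)
  set K := bakerMix (M + M)
  have hF : F ∈ unitaryGroup _ ℂ := dft_mem_unitaryGroup (NeZero.pos _)
  have hK : K ∈ unitaryGroup _ ℂ := bakerMix_mem_unitaryGroup (NeZero.pos M)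
  have h_comm : Kᴴ * diagonal (double u) * K - Fᴴ * diagonal u * F =
      star F * ((F * Kᴴ) * diagonal (double u) - diagonal u * (F * Kᴴ)) * K := by
    have hF' : star F * F = 1 := mem_unitaryGroup_iff'.1 hF
    have hK' : Kᴴ * K = 1 := mem_unitaryGroup_iff'.1 hK
    simp only [Matrix.mul_sub, Matrix.sub_mul, ← Matrix.mul_assoc, hF', Matrix.one_mul]
    rw [Matrix.mul_assoc _ Kᴴ K, hK', Matrix.mul_one, star_eq_conjTranspose]
  rw [h_comm, frobenius_norm_mul_unitary hK, frobenius_norm_unitary_mul (Unitary.star_mem hF)]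
  refine frobenius_norm_le_of_sum_sq_le (egorovError_nonneg _ _)
    (le_of_eq_of_le ?_ (sum_norm_quantumBaker_sq_mul_sub_double_sq_le_egorovError hu))
  refine sum_congr rfl fun m _ => sum_congr rfl fun m' _ => ?_
  rw [Matrix.sub_apply, diagonal_mul, mul_diagonal, h_entry, mul_comm (u m), ← mul_sub, norm_mul,
    mul_pow, RCLike.norm_conj, norm_sub_rev]

lemma norm_evolve_diagonal_sub_iterate_double_le {u : Fin (M + M) → ℂ} (hu : ∀ x, ‖u x‖ ≤ 1)
    (t : ℕ) : ‖evolve (baker M) t (diagonal u) - diagonal (double^[t] u)‖ ≤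
      (2 ^ t - 1) * egorovError (M + M) (cyclicVar u) := by
  induction t generalizing u with
  | zero => simp [evolve_zero]
  | succ t ih =>
    have h_var : egorovError (M + M) (cyclicVar (double u)) ≤
        2 * egorovError (M + M) (cyclicVar u) :=
      (egorovError_mono _ (cyclicVar_double_le u)).trans_eq (egorovError_four_mul _ _)
    calc ‖evolve (baker M) (t + 1) (diagonal u) - diagonal (double^[t + 1] u)‖
        = ‖evolve (baker M) t (evolve (baker M) 1 (diagonal u) - diagonal (double u)) +
            (evolve (baker M) t (diagonal (double u)) - diagonal (double^[t] (double u)))‖ := by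
          rw [evolve_add, map_sub, Function.iterate_succ_apply, sub_add_sub_cancel]
      _ ≤ egorovError (M + M) (cyclicVar u) +
            (2 ^ t - 1) * egorovError (M + M) (cyclicVar (double u)) := by
          refine (norm_add_le _ _).trans (add_le_add ?_ (ih fun x => hu (x + x)))
          rw [norm_evolve]
          exact norm_evolve_diagonal_sub_le hu
      _ ≤ egorovError (M + M) (cyclicVar u) +
            (2 ^ t - 1) * (2 * egorovError (M + M) (cyclicVar u)) := by
          gcongr
          exact sub_nonneg.2 (one_le_pow₀ one_le_two)
      _ = _ := by ring

lemma norm_evolve_diagonal_sub_iterate_double_le_of_cyclicVar_le {u : Fin (M + M) → ℂ}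
    (hu : ∀ x, ‖u x‖ ≤ 1) {V : ℝ} (hV : cyclicVar u ≤ V) (t : ℕ) :
    ‖evolve (baker M) t (diagonal u) - diagonal (double^[t] u)‖ ≤ 2 ^ t * egorovError (M + M) V :=
  (norm_evolve_diagonal_sub_iterate_double_le hu t).trans <|
    mul_le_mul (sub_le_self _ zero_le_one) (egorovError_mono _ hV) (egorovError_nonneg _ _)
      (by positivity)

end Egorov

section Sampling

/-- The samples of a function on the circle `ℝ/ℤ` at the points `m/N`. -/
def sample (N : ℕ) (g : ℝ → ℂ) (m : Fin N) : ℂ := g (m / N)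

variable {N : ℕ} [NeZero N]

lemma cyclicVar_comp_val (f : ℕ → ℂ) : cyclicVar (fun x : Fin N => f x) =
    ∑ i ∈ range (N - 1), ‖f (i + 1) - f i‖ + ‖f 0 - f (N - 1)‖ := by
  obtain ⟨n, rfl⟩ := Nat.exists_eq_succ_of_ne_zero (NeZero.ne N)
  rw [cyclicVar, Fin.sum_univ_castSucc, ← Fin.sum_univ_eq_sum_range]
  simp

lemma cyclicVar_sample_le {g : ℝ → ℂ} {K : ℝ≥0} (hg : LipschitzWith K g) :
    cyclicVar (sample N g) ≤ 2 * K := by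
  have hN : (0 : ℝ) < N := Nat.cast_pos.2 (NeZero.pos N)
  have h_jump (i j : ℕ) : ‖g (i / N) - g (j / N)‖ ≤ K * (|(i : ℝ) - j| / N) := by
    simpa [dist_eq_norm, ← sub_div, abs_div] using hg.dist_le_mul (i / N) (j / N)
  calc cyclicVar (sample N g)
      = ∑ i ∈ range (N - 1), ‖g ((i + 1 : ℕ) / N) - g (i / N)‖ +
          ‖g ((0 : ℕ) / N) - g ((N - 1 : ℕ) / N)‖ := cyclicVar_comp_val fun i => g (i / N)
    _ ≤ ∑ _i ∈ range (N - 1), (K : ℝ) * (1 / N) + K * ((N - 1 : ℕ) / N) := by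
        gcongr with i
        · simpa using h_jump (i + 1) i
        · simpa using h_jump 0 (N - 1)
    _ = 2 * K * ((N - 1 : ℕ) / N) := by
        rw [sum_const, card_range, nsmul_eq_mul]
        ring
    _ ≤ 2 * K := mul_le_of_le_one_right (by positivity)
        (div_le_one_of_le₀ (by exact_mod_cast Nat.sub_le N 1) hN.le)

lemma norm_sample_sub_le {g : ℝ → ℂ} {K : ℝ≥0} (hg : LipschitzWith K g) (m : Fin N) :
    ‖sample N g m - g 0‖ ≤ K := by
  have hN : (0 : ℝ) < N := Nat.cast_pos.2 (NeZero.pos N)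
  have hm : (m : ℝ) / N ≤ 1 := (div_le_one hN).2 (by exact_mod_cast m.2.le)
  calc ‖sample N g m - g 0‖ ≤ K * (m / N) := by
        simpa [dist_eq_norm, sample] using hg.dist_le_mul (m / N) 0
    _ ≤ K := mul_le_of_le_one_right K.2 hm

end Sampling

section MomentumOp

/-- The function `g(p̂)` of the momentum operator `p̂`, which the discrete Fourier transform
diagonalises. -/
def momentumOp (N : ℕ) (g : ℝ → ℂ) : Matrix (Fin N) (Fin N) ℂ :=
  (dft N)ᴴ * diagonal (sample N g) * dft N

variable {N : ℕ}

lemma momentumOp_sub (g h : ℝ → ℂ) :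
    momentumOp N (g - h) = momentumOp N g - momentumOp N h := by
  rw [momentumOp, momentumOp, momentumOp, ← Matrix.sub_mul, ← Matrix.mul_sub, diagonal_sub]
  rfl

variable [NeZero N]

lemma momentumOp_const (c : ℂ) : momentumOp N (fun _ => c) = diagonal fun _ => c := by
  have h_diag : diagonal (sample N fun _ => c) = c • 1 := (smul_one_eq_diagonal c).symm
  have hF : (dft N)ᴴ * dft N = 1 := mem_unitaryGroup_iff'.1 (dft_mem_unitaryGroup (NeZero.pos N))
  rw [momentumOp, h_diag, Matrix.mul_smul, Matrix.mul_one, Matrix.smul_mul, hF,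
    smul_one_eq_diagonal]

lemma norm_momentumOp_le {g : ℝ → ℂ} {c : ℝ} (hc : 0 ≤ c) (hg : ∀ m, ‖sample N g m‖ ≤ c) :
    ‖momentumOp N g‖ ≤ c * √N := by
  have hF : dft N ∈ unitaryGroup _ ℂ := dft_mem_unitaryGroup (NeZero.pos N)
  rw [momentumOp, frobenius_norm_mul_unitary hF, ← star_eq_conjTranspose,
    frobenius_norm_unitary_mul (Unitary.star_mem hF)]
  simpa using frobenius_norm_diagonal_le hc hg

lemma norm_mul_momentumOp_le {g : ℝ → ℂ} (hg : ∀ x, ‖g x‖ ≤ 1) (X : Matrix (Fin N) (Fin N) ℂ) :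
    ‖X * momentumOp N g‖ ≤ ‖X‖ := by
  have hF : dft N ∈ unitaryGroup _ ℂ := dft_mem_unitaryGroup (NeZero.pos N)
  rw [momentumOp, ← Matrix.mul_assoc, frobenius_norm_mul_unitary hF, ← Matrix.mul_assoc]
  refine (frobenius_norm_mul_diagonal_le zero_le_one (fun m => hg _) _).trans_eq ?_
  rw [one_mul, ← star_eq_conjTranspose, frobenius_norm_mul_unitary (Unitary.star_mem hF)]

lemma norm_mul_evolve_momentumOp_le (U : unitaryGroup (Fin N) ℂ) {g : ℝ → ℂ}
    (hg : ∀ x, ‖g x‖ ≤ 1) (t : ℕ) (X : Matrix (Fin N) (Fin N) ℂ) :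
    ‖X * evolve U t (momentumOp N g)‖ ≤ ‖X‖ := by
  obtain ⟨Y, rfl⟩ := EquivLike.surjective (evolve U t) X
  rw [← map_mul, norm_evolve, norm_evolve]
  exact norm_mul_momentumOp_le hg Y

lemma norm_offDiag_momentumOp_le {g : ℝ → ℂ} {K : ℝ≥0} (hg : LipschitzWith K g) :
    ‖offDiag (momentumOp N g)‖ ≤ K * √N :=
  calc ‖offDiag (momentumOp N g)‖
      ≤ ‖offDiag (momentumOp N fun _ => g 0)‖ + ‖momentumOp N g - momentumOp N fun _ => g 0‖ :=
        norm_offDiag_le_add _ _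
    _ = ‖momentumOp N (g - fun _ => g 0)‖ := by
        rw [momentumOp_const, offDiag_diagonal, norm_zero, zero_add, ← momentumOp_const,
          ← momentumOp_sub]
    _ ≤ K * √N := norm_momentumOp_le K.2 fun m => norm_sample_sub_le hg m

end MomentumOp

section LeftHalf

/-- The left half of the `2M` positions, on which the baker's map applies its first branch. -/
def leftHalf (M : ℕ) : Set (Fin (M + M)) := {x | (x : ℕ) < M}

variable {M : ℕ}

lemma mem_leftHalf {x : Fin (M + M)} : x ∈ leftHalf M ↔ (x : ℕ) < M := Iff.rfl

lemma add_self_div (x : Fin (M + M)) : ((x + x : Fin (M + M)) : ℝ) / (M + M : ℕ) =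
    2 * (x / (M + M : ℕ)) - (leftHalf M)ᶜ.indicator 1 x := by
  have hx := x.2
  have hM : (M : ℝ) ≠ 0 := by exact_mod_cast (by omega : M ≠ 0)
  by_cases h : x ∈ leftHalf M
  · have h_val : ((x + x : Fin (M + M)) : ℕ) = 2 * x := by
      rw [mem_leftHalf] at h
      rw [Fin.val_add, Nat.mod_eq_of_lt (by omega), two_mul]
    simp [h, h_val, mul_div_assoc]
  · have h_val : ((x + x : Fin (M + M)) : ℕ) + (M + M) = 2 * x := by
      rw [mem_leftHalf] at h
      rw [Fin.val_add, Nat.mod_eq_sub_mod (by omega), Nat.mod_eq_of_lt (by omega)]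
      omega
    have h_val' : ((x + x : Fin (M + M)) : ℝ) = 2 * x - (M + M) :=
      eq_sub_of_add_eq (by exact_mod_cast h_val)
    rw [h_val', Set.indicator_of_mem h, Pi.one_apply]
    push_cast
    field_simp

lemma mem_leftHalf_iff_of_bakerMix_ne_zero {i j : Fin (M + M)} (h : bakerMix (M + M) i j ≠ 0) :
    i ∈ leftHalf M ↔ j ∈ leftHalf M := by
  have h_half : (M + M) / 2 = M := by omega
  rw [mem_leftHalf, mem_leftHalf]
  contrapose! h
  simp only [bakerMix, of_apply, h_half]
  rw [if_neg (by omega), if_neg (by omega)]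

lemma diagonal_mul_bakerMix_conjTranspose {s : Set (Fin (M + M))}
    (hs : s = leftHalf M ∨ s = (leftHalf M)ᶜ) :
    (bakerMix (M + M))ᴴ * diagonal (s.indicator 1) =
      diagonal (s.indicator 1) * (bakerMix (M + M))ᴴ := by
  ext i j
  rw [mul_diagonal, diagonal_mul, conjTranspose_apply]
  by_cases h : bakerMix (M + M) j i = 0
  · simp [h]
  have h_mem : j ∈ s ↔ i ∈ s := by
    have h_iff := mem_leftHalf_iff_of_bakerMix_ne_zero h
    rcases hs with rfl | rfl
    · exact h_iff
    · exact not_congr h_iff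
  by_cases hi : i ∈ s <;> simp [h_mem, hi]

variable [NeZero M]

lemma cyclicVar_indicator_compl {N : ℕ} [NeZero N] (s : Set (Fin N)) :
    cyclicVar (sᶜ.indicator 1) = cyclicVar (s.indicator 1) := by
  refine sum_congr rfl fun x _ => ?_
  rw [Set.indicator_compl, Pi.sub_apply, Pi.sub_apply, Pi.one_apply, Pi.one_apply,
    sub_sub_sub_cancel_left, norm_sub_rev]

lemma cyclicVar_indicator_leftHalf_le : cyclicVar ((leftHalf M).indicator 1) ≤ 2 := by
  have hM := NeZero.pos M
  let f (i : ℕ) : ℂ := if i < M then 1 else 0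
  calc cyclicVar ((leftHalf M).indicator 1)
      = cyclicVar fun x : Fin (M + M) => f x := by
        congr! with x
        by_cases h : x ∈ leftHalf M
        · rw [Set.indicator_of_mem h]
          exact (if_pos h).symm
        · rw [Set.indicator_of_notMem h]
          exact (if_neg h).symm
    _ = ∑ i ∈ range (M + M - 1), ‖f (i + 1) - f i‖ + ‖f 0 - f (M + M - 1)‖ := cyclicVar_comp_val f
    _ ≤ ∑ i ∈ range (M + M - 1), (if i = M - 1 then 1 else 0) + 1 := by
        gcongr with i
        · simp only [f]
          split_ifs <;> first | omega | simp
        · simp only [f]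
          rw [if_pos hM, if_neg (by omega)]
          simp
    _ = 2 := by
        rw [sum_ite_eq', if_pos (mem_range.2 (by omega))]
        norm_num

lemma norm_evolve_diagonal_indicator_sub_le {s : Set (Fin (M + M))}
    (hs : s = leftHalf M ∨ s = (leftHalf M)ᶜ) (t : ℕ) :
    ‖evolve (baker M) t (diagonal (s.indicator 1)) -
      diagonal (((fun y => y + y)^[t] ⁻¹' s).indicator 1)‖ ≤ 2 ^ t * egorovError (M + M) 2 := by
  have h_one (x : Fin (M + M)) : ‖s.indicator (1 : Fin (M + M) → ℂ) x‖ ≤ 1 :=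
    (norm_indicator_le_norm_self _ _).trans_eq norm_one
  have h_var : cyclicVar (s.indicator 1) ≤ 2 := by
    rcases hs with rfl | rfl
    · exact cyclicVar_indicator_leftHalf_le
    · exact (cyclicVar_indicator_compl _).trans_le cyclicVar_indicator_leftHalf_le
  rw [← iterate_double_indicator]
  exact norm_evolve_diagonal_sub_iterate_double_le_of_cyclicVar_le h_one h_var t

end LeftHalf

section MomentumEgorov

/-- The composition of `g` with the branch `x ↦ (x + e) / 2` of the inverse of the doubling map. -/
def branch (e : ℝ) (g : ℝ → ℂ) (x : ℝ) : ℂ := g ((x + e) / 2)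

lemma lipschitzWith_branch {g : ℝ → ℂ} {K : ℝ≥0} (hg : LipschitzWith K g) (e : ℝ) :
    LipschitzWith (K / 2) (branch e g) := by
  refine LipschitzWith.of_dist_le_mul fun x y => (hg.dist_le_mul _ _).trans_eq ?_
  rw [Real.dist_eq, Real.dist_eq, ← sub_div, add_sub_add_right_eq_sub, abs_div, abs_two]
  push_cast
  ring

variable {M : ℕ}

lemma diagonal_sample_eq (g : ℝ → ℂ) : diagonal (sample (M + M) g) =
    diagonal ((leftHalf M).indicator 1) * diagonal (double (sample (M + M) (branch 0 g))) +
      diagonal ((leftHalf M)ᶜ.indicator 1) *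
        diagonal (double (sample (M + M) (branch 1 g))) := by
  rw [diagonal_mul_diagonal, diagonal_mul_diagonal, diagonal_add]
  congr! 2 with x
  simp only [double, sample, branch, add_self_div]
  by_cases h : x ∈ leftHalf M <;> simp [h]

variable [NeZero M]

lemma evolve_momentumOp (g : ℝ → ℂ) : evolve (baker M) 1 (momentumOp (M + M) g) =
    (bakerMix (M + M))ᴴ * diagonal (sample (M + M) g) * bakerMix (M + M) := by
  have hF : dft (M + M) * (dft (M + M))ᴴ = 1 :=
    mem_unitaryGroup_iff.1 (dft_mem_unitaryGroup (NeZero.pos _))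
  have hB : (baker M : Matrix (Fin (M + M)) (Fin (M + M)) ℂ) =
      (dft (M + M))ᴴ * bakerMix (M + M) := quantumBaker_eq (NeZero.pos _)
  rw [evolve_one_apply, hB, momentumOp, conjTranspose_mul, conjTranspose_conjTranspose]
  set F := dft (M + M)
  set K := bakerMix (M + M)
  calc Kᴴ * F * (Fᴴ * diagonal (sample (M + M) g) * F) * (Fᴴ * K)
      = Kᴴ * (F * Fᴴ) * diagonal (sample (M + M) g) * (F * Fᴴ) * K := by
        simp only [Matrix.mul_assoc]
    _ = _ := by rw [hF, Matrix.mul_one, Matrix.mul_one]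

lemma norm_bakerMix_conj_branch_sub_le {g : ℝ → ℂ} (hg1 : ∀ x, ‖g x‖ ≤ 1) {K : ℝ≥0}
    (hg : LipschitzWith K g) {s : Set (Fin (M + M))}
    (hs : s = leftHalf M ∨ s = (leftHalf M)ᶜ) (e : ℝ) :
    ‖(bakerMix (M + M))ᴴ * (diagonal (s.indicator 1) *
        diagonal (double (sample (M + M) (branch e g)))) * bakerMix (M + M) -
      diagonal (s.indicator 1) * momentumOp (M + M) (branch e g)‖ ≤ egorovError (M + M) K := by
  have h_one (x : Fin (M + M)) : ‖s.indicator (1 : Fin (M + M) → ℂ) x‖ ≤ 1 :=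
    (norm_indicator_le_norm_self _ _).trans_eq norm_one
  have h_var : cyclicVar (sample (M + M) (branch e g)) ≤ K := by
    refine (cyclicVar_sample_le (lipschitzWith_branch hg e)).trans_eq ?_
    push_cast
    ring
  rw [← Matrix.mul_assoc, diagonal_mul_bakerMix_conjTranspose hs, Matrix.mul_assoc,
    Matrix.mul_assoc, ← Matrix.mul_sub, ← Matrix.mul_assoc]
  refine (frobenius_norm_diagonal_mul_le zero_le_one h_one _).trans ?_
  rw [one_mul]
  exact (norm_bakerMix_conj_sub_dft_conj_le fun x => hg1 _).trans (egorovError_mono _ h_var)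

lemma norm_evolve_momentumOp_sub_le {g : ℝ → ℂ} (hg1 : ∀ x, ‖g x‖ ≤ 1) {K : ℝ≥0}
    (hg : LipschitzWith K g) :
    ‖evolve (baker M) 1 (momentumOp (M + M) g) -
      (diagonal ((leftHalf M).indicator 1) * momentumOp (M + M) (branch 0 g) +
        diagonal ((leftHalf M)ᶜ.indicator 1) * momentumOp (M + M) (branch 1 g))‖ ≤
      2 * egorovError (M + M) K := by
  rw [evolve_momentumOp, diagonal_sample_eq, Matrix.mul_add, Matrix.add_mul, add_sub_add_comm,
    two_mul]
  exact (norm_add_le _ _).trans <|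
    add_le_add (norm_bakerMix_conj_branch_sub_le hg1 hg (Or.inl rfl) 0)
      (norm_bakerMix_conj_branch_sub_le hg1 hg (Or.inr rfl) 1)

lemma norm_offDiag_evolve_leftHalf_add_le {g₀ g₁ : ℝ → ℂ} (hg₀ : ∀ x, ‖g₀ x‖ ≤ 1)
    (hg₁ : ∀ x, ‖g₁ x‖ ≤ 1) {t : ℕ} {c : ℝ}
    (hc₀ : ‖offDiag (evolve (baker M) t (momentumOp (M + M) g₀))‖ ≤ c)
    (hc₁ : ‖offDiag (evolve (baker M) t (momentumOp (M + M) g₁))‖ ≤ c) :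
    ‖offDiag (evolve (baker M) t
      (diagonal ((leftHalf M).indicator 1) * momentumOp (M + M) g₀ +
        diagonal ((leftHalf M)ᶜ.indicator 1) * momentumOp (M + M) g₁))‖ ≤
      √2 * c + 2 * (2 ^ t * egorovError (M + M) 2) := by
  set P₀ := evolve (baker M) t (diagonal ((leftHalf M).indicator 1)) with hP₀
  set P₁ := evolve (baker M) t (diagonal ((leftHalf M)ᶜ.indicator 1)) with hP₁
  set Y₀ := evolve (baker M) t (momentumOp (M + M) g₀) with hY₀
  set Y₁ := evolve (baker M) t (momentumOp (M + M) g₁) with hY₁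
  set s := (fun y => y + y)^[t] ⁻¹' leftHalf M
  have h_proj₀ : ‖(P₀ - diagonal (s.indicator 1)) * Y₀‖ ≤ 2 ^ t * egorovError (M + M) 2 :=
    (norm_mul_evolve_momentumOp_le _ hg₀ t _).trans <|
      norm_evolve_diagonal_indicator_sub_le (Or.inl rfl) t
  have h_proj₁ : ‖(P₁ - diagonal (sᶜ.indicator 1)) * Y₁‖ ≤ 2 ^ t * egorovError (M + M) 2 :=
    (norm_mul_evolve_momentumOp_le _ hg₁ t _).trans <|
      norm_evolve_diagonal_indicator_sub_le (Or.inr rfl) t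
  rw [map_add, map_mul, map_mul, ← hP₀, ← hP₁, ← hY₀, ← hY₁, two_mul]
  refine (norm_offDiag_le_add _ (diagonal (s.indicator 1) * Y₀ +
    diagonal (sᶜ.indicator 1) * Y₁)).trans ?_
  rw [add_sub_add_comm, ← Matrix.sub_mul, ← Matrix.sub_mul]
  exact add_le_add (norm_offDiag_indicator_add_le s hc₀ hc₁)
    ((norm_add_le _ _).trans (add_le_add h_proj₀ h_proj₁))

/-- Each time step splits a function of momentum between the two halves of the position space. The
rows of the two parts are disjoint, so their off-diagonal norms add up in mean square, while each
has half the Lipschitz constant: the off-diagonal norm decreases by the factor `√2 / 2`. -/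
lemma norm_offDiag_evolve_momentumOp_le {g : ℝ → ℂ} (hg1 : ∀ x, ‖g x‖ ≤ 1) {K : ℝ≥0}
    (hg : LipschitzWith K g) (t : ℕ) :
    ‖offDiag (evolve (baker M) t (momentumOp (M + M) g))‖ ≤
      (√2 / 2) ^ t * (K * √(M + M : ℕ)) +
        2 ^ t * (4 * (egorovError (M + M) 2 + egorovError (M + M) K)) := by
  have h_err (V : ℝ) := egorovError_nonneg (M + M) V
  induction t generalizing g K with
  | zero =>
    rw [evolve_zero]
    linarith [norm_offDiag_momentumOp_le (N := M + M) hg, h_err 2, h_err K]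
  | succ t ih =>
    set b := (√2 / 2) ^ t * ((K / 2 : ℝ≥0) * √(M + M : ℕ)) +
      2 ^ t * (4 * (egorovError (M + M) 2 + egorovError (M + M) K)) with hb
    have h_branch (e : ℝ) :
        ‖offDiag (evolve (baker M) t (momentumOp (M + M) (branch e g)))‖ ≤ b := by
      refine (ih (fun x => hg1 _) (lipschitzWith_branch hg e)).trans ?_
      rw [hb]
      gcongr
      exact egorovError_mono _ (NNReal.coe_le_coe.2 (half_le_self K.2))
    have h_step : ‖offDiag (evolve (baker M) (t + 1) (momentumOp (M + M) g))‖ ≤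
        √2 * b + 2 * (2 ^ t * egorovError (M + M) 2) + 2 * egorovError (M + M) K := by
      rw [evolve_add]
      refine (norm_offDiag_le_add _ _).trans (add_le_add
        (norm_offDiag_evolve_leftHalf_add_le (fun x => hg1 _) (fun x => hg1 _)
          (h_branch 0) (h_branch 1)) ?_)
      rw [← map_sub, norm_evolve]
      exact norm_evolve_momentumOp_sub_le hg1 hg
    have h_sqrt : √2 ≤ 3 / 2 := Real.sqrt_le_left (by norm_num) |>.2 (by norm_num)
    have h_pow : (1 : ℝ) ≤ 2 ^ t := one_le_pow₀ one_le_two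
    calc _ ≤ _ := h_step
      _ = (√2 / 2) ^ (t + 1) * (K * √(M + M : ℕ)) +
          (√2 * (2 ^ t * (4 * (egorovError (M + M) 2 + egorovError (M + M) K))) +
            (2 * 2 ^ t * egorovError (M + M) 2 + 1 * (2 * egorovError (M + M) K))) := by
          rw [hb, pow_succ]
          push_cast
          ring
      _ ≤ (√2 / 2) ^ (t + 1) * (K * √(M + M : ℕ)) +
          (3 / 2 * (2 ^ t * (4 * (egorovError (M + M) 2 + egorovError (M + M) K))) +
            (2 * 2 ^ t * egorovError (M + M) 2 + 2 ^ t * (2 * egorovError (M + M) K))) := by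
          have := h_err 2
          have := h_err K
          gcongr
      _ = _ := by ring

end MomentumEgorov

section Wave

/-- The plane wave of frequency `k` and amplitude `c` on the line. -/
def wave (c : Circle) (k : ℤ) (x : ℝ) : ℂ := c * 𝐞 (k * x)

lemma norm_wave (c : Circle) (k : ℤ) (x : ℝ) : ‖wave c k x‖ = 1 := by
  rw [wave, norm_mul, Circle.norm_coe, Circle.norm_coe, one_mul]

lemma lipschitzWith_wave (c : Circle) (k : ℤ) :
    LipschitzWith (2 * NNReal.pi * ‖k‖₊) (wave c k) := by
  refine LipschitzWith.of_dist_le_mul fun x y => ?_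
  rw [dist_eq_norm, wave, wave, ← mul_sub, norm_mul, Circle.norm_coe, one_mul]
  refine (norm_fourierChar_sub_le _ _).trans_eq ?_
  rw [← mul_sub, abs_mul, ← Real.dist_eq]
  push_cast
  rw [Int.norm_eq_abs, NNReal.coe_real_pi]
  ring

lemma cyclicVar_sample_wave_le {N : ℕ} [NeZero N] (c : Circle) (k : ℤ) :
    cyclicVar (sample N (wave c k)) ≤ 4 * Real.pi * |(k : ℝ)| := by
  refine (cyclicVar_sample_le (lipschitzWith_wave c k)).trans_eq ?_
  push_cast
  rw [Int.norm_eq_abs, NNReal.coe_real_pi]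
  ring

lemma double_sample_wave {M : ℕ} (c : Circle) (k : ℤ) :
    double (sample (M + M) (wave c k)) = sample (M + M) (wave c (2 * k)) := by
  funext x
  simp only [double, sample, wave, add_self_div]
  congr 2
  by_cases h : x ∈ leftHalf M
  · rw [Set.indicator_of_notMem (Set.notMem_compl_iff.2 h)]
    congr 1
    push_cast
    ring
  · rw [Set.indicator_of_mem h, ← fourierChar_add_intCast _ k]
    congr 1
    push_cast [Pi.one_apply]
    ring

lemma iterate_double_sample_wave {M : ℕ} (c : Circle) (k : ℤ) (t : ℕ) :
    double^[t] (sample (M + M) (wave c k)) = sample (M + M) (wave c (2 ^ t * k)) := by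
  induction t generalizing k with
  | zero => simp
  | succ t ih => rw [Function.iterate_succ_apply, double_sample_wave, ih, pow_succ, mul_assoc]

variable {N : ℕ}

lemma trace_conjTranspose_diagonal_wave_mul (hN : 0 < N) (c : Circle) {k l : ℤ}
    (h : ¬ (N : ℤ) ∣ l - k) :
    ((diagonal (sample N (wave c k)))ᴴ * diagonal (sample N (wave c l))).trace = 0 := by
  have h_term (m : Fin N) : conj (sample N (wave c k) m) * sample N (wave c l) m =
      𝐞 (m * ((l - k : ℤ) / N)) := by
    have h_arg : (m * ((l - k : ℤ) / N) : ℝ) = -(k * (m / N)) + l * (m / N) := by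
      push_cast
      ring
    rw [sample, sample, wave, wave, map_mul, conj_fourierChar, mul_mul_mul_comm,
      ← Circle.coe_inv_eq_conj, ← Circle.coe_mul, inv_mul_cancel, Circle.coe_one, one_mul, h_arg,
      AddChar.map_add_eq_mul, Circle.coe_mul]
  rw [diagonal_conjTranspose, diagonal_mul_diagonal, trace_diagonal]
  exact (sum_congr rfl fun m _ => h_term m).trans ((sum_fourierChar_mul_div hN _).trans (if_neg h))

lemma momentumOp_wave_apply (k : ℤ) (i j : Fin N) :
    momentumOp N (wave 1 (-k)) i j = if (i : ℤ) ≡ j + k [ZMOD N] then 1 else 0 := by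
  have hN : (N : ℂ) ≠ 0 := Nat.cast_ne_zero.2 i.pos.ne'
  have h_term (m : Fin N) : sample N (wave 1 (-k)) m * 𝐞 (m * ((i - j) / N)) =
      𝐞 (m * (((i - j - k : ℤ) : ℝ) / N)) := by
    rw [sample, wave, Circle.coe_one, one_mul, ← Circle.coe_mul, ← AddChar.map_add_eq_mul]
    congr 2
    push_cast
    ring
  have h_iff : (N : ℤ) ∣ i - j - k ↔ (i : ℤ) ≡ j + k [ZMOD N] := by
    rw [Int.modEq_comm, Int.modEq_iff_dvd, sub_sub]
  rw [momentumOp, dft_conjTranspose_mul_diagonal_mul_apply, sum_congr rfl fun m _ => h_term m,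
    sum_fourierChar_mul_div i.pos]
  simp only [h_iff]
  split_ifs <;> simp [hN]

/-- The phase by which the quantum translation `T(k)` differs from the product of a translation in
momentum with a translation in position. -/
def weylPhase (N : ℕ) (k : ℤ × ℤ) : Circle := 𝐞 (-(k.1 * k.2 / (2 * N)))

lemma translation_eq (k : ℤ × ℤ) : translation N k =
    diagonal (sample N (wave (weylPhase N k) k.2)) * momentumOp N (wave 1 (-k.1)) := by
  ext i j
  rw [diagonal_mul, momentumOp_wave_apply, translation, of_apply]
  split_ifs
  · rw [mul_one, sample, wave, weylPhase, Real.fourierChar_apply, Real.fourierChar_apply]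
    congr 2 <;> push_cast <;> ring
  · rw [mul_zero]

lemma diag_translation_eq_zero {k : ℤ × ℤ} (hk : k.1 ≠ 0) (hkN : |k.1| < N) :
    (translation N k).diag = 0 := by
  ext i
  rw [diag_apply, translation, of_apply, if_neg, Pi.zero_apply]
  rw [Int.modEq_iff_dvd, add_sub_cancel_left]
  exact fun h => hk (Int.eq_zero_of_abs_lt_dvd h hkN)

variable [NeZero N]

lemma norm_translation_le (k : ℤ × ℤ) : ‖translation N k‖ ≤ √N := by
  have h_momentum : ‖momentumOp N (wave 1 (-k.1))‖ ≤ 1 * √N :=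
    norm_momentumOp_le zero_le_one fun m => (norm_wave _ _ _).le
  rw [one_mul] at h_momentum
  rw [translation_eq, ← one_mul √(N : ℝ)]
  exact (frobenius_norm_diagonal_mul_le zero_le_one (fun m => (norm_wave _ _ _).le) _).trans
    (mul_le_mul_of_nonneg_left h_momentum zero_le_one)

end Wave

section Autocorrelation

variable {M : ℕ} [NeZero M]

lemma norm_evolve_translation_sub_le (k : ℤ × ℤ) (r : ℕ) :
    ‖evolve (baker M) r (translation (M + M) k) -
      diagonal (sample (M + M) (wave (weylPhase (M + M) k) (2 ^ r * k.2))) *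
        evolve (baker M) r (momentumOp (M + M) (wave 1 (-k.1)))‖ ≤
      2 ^ r * egorovError (M + M) (4 * Real.pi * |(k.2 : ℝ)|) := by
  rw [translation_eq, map_mul, ← Matrix.sub_mul, ← iterate_double_sample_wave]
  exact (norm_mul_evolve_momentumOp_le _ (fun x => (norm_wave _ _ x).le) _ _).trans <|
    norm_evolve_diagonal_sub_iterate_double_le_of_cyclicVar_le (fun x => (norm_wave _ _ _).le)
      (cyclicVar_sample_wave_le _ _) r

lemma norm_trace_translation_mul_evolve_le_of_fst_eq_zero {k : ℤ × ℤ} (hk₁ : k.1 = 0)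
    (hk₂ : k.2 ≠ 0) {r : ℕ} (hr : r ≠ 0) (hkr : |k.2| * 2 ^ r < (M + M : ℕ)) :
    ‖((translation (M + M) k)ᴴ * evolve (baker M) r (translation (M + M) k)).trace‖ ≤
      √(M + M : ℕ) * (2 ^ r * egorovError (M + M) (4 * Real.pi * |(k.2 : ℝ)|)) := by
  have h_one : momentumOp (M + M) (wave 1 (-k.1)) = 1 := by
    have h_wave : wave 1 (-k.1) = fun _ => 1 := by
      funext x
      simp [wave, hk₁]
    rw [h_wave, momentumOp_const, diagonal_one]
  have h_err := norm_evolve_translation_sub_le (M := M) k r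
  set D := diagonal (sample (M + M) (wave (weylPhase (M + M) k) (2 ^ r * k.2)))
  have h_orth : ((translation (M + M) k)ᴴ * D).trace = 0 := by
    rw [translation_eq, h_one, Matrix.mul_one]
    refine trace_conjTranspose_diagonal_wave_mul (NeZero.pos _) _ fun h_dvd => ?_
    have h_pow : (2 : ℤ) ≤ 2 ^ r := le_self_pow₀ one_le_two hr
    have h_pos : 0 < |k.2| := abs_pos.2 hk₂
    have h_abs : |2 ^ r * k.2 - k.2| = (2 ^ r - 1) * |k.2| := by
      rw [← sub_one_mul, abs_mul, abs_of_nonneg (by linarith)]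
    have h_zero := Int.eq_zero_of_abs_lt_dvd h_dvd (by rw [h_abs]; nlinarith)
    rw [h_zero, abs_zero] at h_abs
    nlinarith
  rw [h_one, map_one, Matrix.mul_one] at h_err
  rw [← sub_zero (trace _), ← h_orth, ← trace_sub, ← Matrix.mul_sub]
  exact (norm_trace_conjTranspose_mul_le _ _).trans
    (mul_le_mul (norm_translation_le k) h_err (norm_nonneg _) (Real.sqrt_nonneg _))

lemma norm_trace_translation_mul_evolve_le_of_fst_ne_zero {k : ℤ × ℤ} (hk₁ : k.1 ≠ 0)
    (hkN : |k.1| < (M + M : ℕ)) (r : ℕ) :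
    ‖((translation (M + M) k)ᴴ * evolve (baker M) r (translation (M + M) k)).trace‖ ≤
      √(M + M : ℕ) * ((√2 / 2) ^ r * (2 * Real.pi * |(k.1 : ℝ)| * √(M + M : ℕ)) +
        2 ^ r * (4 * (egorovError (M + M) 2 + egorovError (M + M) (2 * Real.pi * |(k.1 : ℝ)|))) +
        2 ^ r * egorovError (M + M) (4 * Real.pi * |(k.2 : ℝ)|)) := by
  have h_lip : ((2 * NNReal.pi * ‖-k.1‖₊ : ℝ≥0) : ℝ) = 2 * Real.pi * |(k.1 : ℝ)| := by
    push_cast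
    rw [norm_neg, Int.norm_eq_abs, NNReal.coe_real_pi]
  have h_momentum := norm_offDiag_evolve_momentumOp_le (M := M)
    (fun x => (norm_wave 1 (-k.1) x).le) (lipschitzWith_wave 1 (-k.1)) r
  rw [h_lip] at h_momentum
  refine (norm_trace_conjTranspose_mul_le_offDiag (diag_translation_eq_zero hk₁ hkN) _).trans ?_
  refine mul_le_mul (norm_translation_le k) ?_ (norm_nonneg _) (Real.sqrt_nonneg _)
  refine (norm_offDiag_le_add _ _).trans (add_le_add ?_ (norm_evolve_translation_sub_le k r))
  refine (norm_offDiag_diagonal_mul_le zero_le_one (fun x => (norm_wave _ _ _).le) _).trans ?_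
  rwa [one_mul]

/-- The size of the frequency `k`, in which the bounds for the translation `T(k)` are linear. -/
def freqSize (k : ℤ × ℤ) : ℝ := 1 + |(k.1 : ℝ)| + |(k.2 : ℝ)|

lemma one_le_freqSize (k : ℤ × ℤ) : 1 ≤ freqSize k := by
  rw [freqSize, add_assoc]
  exact le_add_of_nonneg_right (by positivity)

lemma sqrt_mul_abs_intCast_le {a c : ℝ} (hc : 0 ≤ c) (hac : a ≤ c ^ 2) (k : ℤ) :
    √(a * |(k : ℝ)|) ≤ c * |(k : ℝ)| := by
  have h_sq : |(k : ℝ)| ≤ |(k : ℝ)| ^ 2 := by exact_mod_cast Int.le_self_sq |k|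
  refine Real.sqrt_le_iff.2 ⟨by positivity, ?_⟩
  rw [mul_pow]
  exact mul_le_mul hac h_sq (abs_nonneg _) (sq_nonneg c)

lemma egorovError_add_le (N : ℕ) (k : ℤ × ℤ) :
    4 * (egorovError N 2 + egorovError N (2 * Real.pi * |(k.1 : ℝ)|)) +
      egorovError N (4 * Real.pi * |(k.2 : ℝ)|) ≤ 48 * freqSize k * √√N := by
  have h_pi := Real.pi_lt_d2
  have h₀ : √2 ≤ 3 := Real.sqrt_le_iff.2 (by norm_num)
  have h₁ : √(2 * Real.pi * |(k.1 : ℝ)|) ≤ 3 * |(k.1 : ℝ)| :=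
    sqrt_mul_abs_intCast_le (by norm_num) (by linarith) k.1
  have h₂ : √(4 * Real.pi * |(k.2 : ℝ)|) ≤ 4 * |(k.2 : ℝ)| :=
    sqrt_mul_abs_intCast_le (by norm_num) (by linarith) k.2
  calc _ = (16 * √2 + 16 * √(2 * Real.pi * |(k.1 : ℝ)|) + 4 * √(4 * Real.pi * |(k.2 : ℝ)|)) *
        √√N := by
        simp only [egorovError]
        ring
    _ ≤ (16 * 3 + 16 * (3 * |(k.1 : ℝ)|) + 4 * (4 * |(k.2 : ℝ)|)) * √√N := by gcongr
    _ ≤ 48 * freqSize k * √√N := by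
        gcongr
        rw [freqSize]
        linarith [abs_nonneg (k.2 : ℝ)]

lemma norm_trace_translation_mul_evolve_le {k : ℤ × ℤ} (hk : k ≠ 0) {r : ℕ} (hr : r ≠ 0)
    (hkN : |k.1| < (M + M : ℕ)) (hkr : |k.2| * 2 ^ r < (M + M : ℕ)) :
    ‖((translation (M + M) k)ᴴ * evolve (baker M) r (translation (M + M) k)).trace‖ ≤
      √(M + M : ℕ) * freqSize k *
        (7 * (3 / 4) ^ r * √(M + M : ℕ) + 48 * 2 ^ r * √√(M + M : ℕ)) := by
  have h_err (V : ℝ) := egorovError_nonneg (M + M) V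
  have h_trace : ‖((translation (M + M) k)ᴴ *
      evolve (baker M) r (translation (M + M) k)).trace‖ ≤
      √(M + M : ℕ) * ((√2 / 2) ^ r * (2 * Real.pi * |(k.1 : ℝ)| * √(M + M : ℕ)) +
        2 ^ r * (4 * (egorovError (M + M) 2 + egorovError (M + M) (2 * Real.pi * |(k.1 : ℝ)|))) +
        2 ^ r * egorovError (M + M) (4 * Real.pi * |(k.2 : ℝ)|)) := by
    by_cases hk₁ : k.1 = 0
    · refine (norm_trace_translation_mul_evolve_le_of_fst_eq_zero hk₁
        (fun hk₂ => hk (Prod.ext hk₁ hk₂)) hr hkr).trans ?_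
      gcongr
      have := h_err 2
      have := h_err (2 * Real.pi * |(k.1 : ℝ)|)
      exact le_add_of_nonneg_left (by positivity)
    · exact norm_trace_translation_mul_evolve_le_of_fst_ne_zero hk₁ hkN r
  have h_sqrt : √2 ≤ 3 / 2 := Real.sqrt_le_iff.2 (by norm_num)
  have h_rate : √2 / 2 ≤ 3 / 4 := by linarith
  have h_freq : 2 * Real.pi * |(k.1 : ℝ)| ≤ 7 * freqSize k := by
    rw [freqSize]
    nlinarith [Real.pi_lt_d2, abs_nonneg (k.1 : ℝ), abs_nonneg (k.2 : ℝ)]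
  calc _ ≤ _ := h_trace
    _ = √(M + M : ℕ) * ((√2 / 2) ^ r * (2 * Real.pi * |(k.1 : ℝ)| * √(M + M : ℕ)) +
        2 ^ r * (4 * (egorovError (M + M) 2 + egorovError (M + M) (2 * Real.pi * |(k.1 : ℝ)|)) +
          egorovError (M + M) (4 * Real.pi * |(k.2 : ℝ)|))) := by ring
    _ ≤ √(M + M : ℕ) * ((3 / 4) ^ r * (7 * freqSize k * √(M + M : ℕ)) +
        2 ^ r * (48 * freqSize k * √√(M + M : ℕ))) := by
        gcongr
        exact egorovError_add_le (M + M) k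
    _ = _ := by ring

end Autocorrelation

section Averaging

variable {𝕜 : Type*} [RCLike 𝕜]

/-- Van der Corput's argument: adding `v n` to the sum of its predecessors costs at most
`c 0 + 2 ∑ j, c (j + 1)`, because each predecessor has small inner product with `v n`. -/
lemma norm_sum_range_sq_le {E : Type*} [NormedAddCommGroup E] [InnerProductSpace 𝕜 E] {v : ℕ → E}
    {c : ℕ → ℝ} {T : ℕ} (hv : ∀ s, ∀ r ≤ T, ‖inner 𝕜 (v s) (v (s + r))‖ ≤ c r) :
    ‖∑ t ∈ range (T + 1), v t‖ ^ 2 ≤ (T + 1 : ℕ) * (c 0 + 2 * ∑ j ∈ range T, c (j + 1)) := by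
  have h_inner {n : ℕ} (hn : n ≤ T) :
      ‖inner 𝕜 (∑ t ∈ range n, v t) (v n)‖ ≤ ∑ j ∈ range T, c (j + 1) :=
    calc ‖inner 𝕜 (∑ t ∈ range n, v t) (v n)‖ ≤ ∑ s ∈ range n, ‖inner 𝕜 (v s) (v n)‖ := by
          rw [sum_inner]
          exact norm_sum_le _ _
      _ ≤ ∑ s ∈ range n, c (n - 1 - s + 1) := by
          refine sum_le_sum fun s hs => ?_
          rw [mem_range] at hs
          have h := hv s (n - 1 - s + 1) (by lia)
          rwa [show s + (n - 1 - s + 1) = n by lia] at h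
      _ = ∑ j ∈ range n, c (j + 1) := sum_range_reflect (fun j => c (j + 1)) n
      _ ≤ ∑ j ∈ range T, c (j + 1) :=
          sum_le_sum_of_subset_of_nonneg (range_subset_range.2 hn) fun j hj _ =>
            (norm_nonneg _).trans (hv 0 (j + 1) (by rw [mem_range] at hj; lia))
  have h_norm (n : ℕ) : ‖v n‖ ^ 2 ≤ c 0 := by
    have h := hv n 0 T.zero_le
    rwa [add_zero, inner_self_eq_norm_sq_to_K, norm_pow, RCLike.norm_ofReal,
      abs_norm] at h
  suffices h : ∀ n ≤ T + 1, ‖∑ t ∈ range n, v t‖ ^ 2 ≤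
      n * (c 0 + 2 * ∑ j ∈ range T, c (j + 1)) from h (T + 1) le_rfl
  intro n
  induction n with
  | zero => simp
  | succ n ih =>
    intro hn
    rw [sum_range_succ, norm_add_sq (𝕜 := 𝕜)]
    push_cast
    linarith [ih (by lia), h_norm n, (RCLike.re_le_norm _).trans (h_inner (by lia : n ≤ T))]

variable {n : Type*} [Fintype n] [DecidableEq n] (U : unitaryGroup n 𝕜)

lemma trace_evolve (t : ℕ) (X : Matrix n n 𝕜) : (evolve U t X).trace = X.trace := by
  rw [evolve, Unitary.conjStarAlgAut_apply, trace_mul_cycle, Unitary.coe_star_mul_self,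
    Matrix.one_mul]

lemma norm_sum_evolve_sq_le {X : Matrix n n 𝕜} {c : ℕ → ℝ} {T : ℕ}
    (hc : ∀ r ≤ T, ‖(Xᴴ * evolve U r X).trace‖ ≤ c r) :
    ‖∑ t ∈ range (T + 1), evolve U t X‖ ^ 2 ≤
      (T + 1 : ℕ) * (c 0 + 2 * ∑ j ∈ range T, c (j + 1)) := by
  rw [← norm_toLp_vec, vec_sum, WithLp.toLp_sum]
  refine norm_sum_range_sq_le (𝕜 := 𝕜) fun s r hr => ?_
  rw [inner_toLp_vec, evolve_add, ← star_eq_conjTranspose, ← map_star, ← map_mul, trace_evolve]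
  exact hc r hr

end Averaging

section Expectation

variable {N : ℕ} (φ : OrthonormalBasis (Fin N) ℂ (StateSpace N))

lemma op_one_apply (v : StateSpace N) : op 1 v = v := by
  rw [op, toLpLin_one, LinearMap.id_apply]

lemma op_mul_apply (A B : Matrix (Fin N) (Fin N) ℂ) (v : StateSpace N) :
    op (A * B) v = op A (op B v) := by
  rw [op, toLpLin_mul_same, LinearMap.comp_apply]

lemma inner_op_conjTranspose_mul (A B : Matrix (Fin N) (Fin N) ℂ) (v : StateSpace N) :
    inner ℂ v (op (Aᴴ * B) v) = inner ℂ (op A v) (op B v) := by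
  rw [op_mul_apply, ← LinearMap.adjoint_inner_right, ← toEuclideanLin_conjTranspose_eq_adjoint]

/-- The vector of the expectation values `⟨φ j, X φ j⟩` of an observable in the states of an
orthonormal basis. -/
def expectVec : Matrix (Fin N) (Fin N) ℂ →ₗ[ℂ] StateSpace N where
  toFun X := WithLp.toLp 2 fun j => inner ℂ (φ j) (op X (φ j))
  map_add' X Y := by
    ext j
    simp [op]
  map_smul' c X := by
    ext j
    simp [op]

lemma expectVec_apply (X : Matrix (Fin N) (Fin N) ℂ) (j : Fin N) :
    expectVec φ X j = inner ℂ (φ j) (op X (φ j)) := rfl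

lemma sum_norm_op_sq (X : Matrix (Fin N) (Fin N) ℂ) : ∑ j, ‖op X (φ j)‖ ^ 2 = ‖X‖ ^ 2 := by
  have h_trace : (∑ j, inner ℂ (φ j) (op (Xᴴ * X) (φ j))) = (Xᴴ * X).trace := by
    rw [← LinearMap.trace_eq_sum_inner, op, toEuclideanLin, toLpLin_eq_toLin, trace_toLin_eq]
  simp only [inner_op_conjTranspose_mul, inner_self_eq_norm_sq_to_K] at h_trace
  rw [← frobenius_norm_sq_eq_trace] at h_trace
  exact_mod_cast h_trace

lemma norm_expectVec_le (X : Matrix (Fin N) (Fin N) ℂ) : ‖expectVec φ X‖ ≤ ‖X‖ := by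
  rw [← sq_le_sq₀ (norm_nonneg _) (norm_nonneg _), EuclideanSpace.norm_sq_eq, ← sum_norm_op_sq φ]
  gcongr with j
  refine (norm_inner_le_norm _ _).trans_eq ?_
  rw [φ.norm_eq_one, one_mul]

variable {φ}

lemma expectVec_evolve_of_eigenbasis {U : unitaryGroup (Fin N) ℂ}
    (hφ : ∀ j, ∃ μ : ℂ, op (U : Matrix (Fin N) (Fin N) ℂ) (φ j) = μ • φ j) (t : ℕ)
    (X : Matrix (Fin N) (Fin N) ℂ) : expectVec φ (evolve U t X) = expectVec φ X := by
  have h_step (Y : Matrix (Fin N) (Fin N) ℂ) : expectVec φ (evolve U 1 Y) = expectVec φ Y := by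
    ext j
    obtain ⟨μ, hμ⟩ := hφ j
    have h_conj (Z : Matrix (Fin N) (Fin N) ℂ) :
        inner ℂ (φ j) (op (evolve U 1 Z) (φ j)) = conj μ * μ * inner ℂ (φ j) (op Z (φ j)) := by
      rw [evolve_one_apply, Matrix.mul_assoc, inner_op_conjTranspose_mul, op_mul_apply, hμ,
        map_smul, inner_smul_left, inner_smul_right, mul_assoc]
    have h_unit : conj μ * μ = 1 := by
      have h := h_conj 1
      rwa [map_one, op_one_apply, inner_self_eq_norm_sq_to_K, φ.norm_eq_one, RCLike.ofReal_one,
        one_pow, mul_one, eq_comm] at h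
    rw [expectVec_apply, h_conj, h_unit, one_mul, expectVec_apply]
  induction t with
  | zero => rw [evolve_zero]
  | succ t ih => rw [add_comm, evolve_add, h_step, ih]

/-- Time averaging does not change the expectation values in eigenstates, but it makes the
observable small as soon as its autocorrelations decay. -/
lemma norm_expectVec_sq_le {U : unitaryGroup (Fin N) ℂ}
    (hφ : ∀ j, ∃ μ : ℂ, op (U : Matrix (Fin N) (Fin N) ℂ) (φ j) = μ • φ j)
    {X : Matrix (Fin N) (Fin N) ℂ} {c : ℕ → ℝ} {T : ℕ}
    (hc : ∀ r ≤ T, ‖(Xᴴ * evolve U r X).trace‖ ≤ c r) :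
    ‖expectVec φ X‖ ^ 2 ≤ (c 0 + 2 * ∑ j ∈ range T, c (j + 1)) / (T + 1 : ℕ) := by
  have hT : (0 : ℝ) < (T + 1 : ℕ) := by positivity
  have h_avg : expectVec φ (∑ t ∈ range (T + 1), evolve U t X) =
      ((T + 1 : ℕ) : ℂ) • expectVec φ X := by
    rw [map_sum, sum_congr rfl fun t _ => expectVec_evolve_of_eigenbasis hφ t X, sum_const,
      card_range, Nat.cast_smul_eq_nsmul]
  have h_sum := norm_expectVec_le φ (∑ t ∈ range (T + 1), evolve U t X)
  rw [h_avg, norm_smul, Complex.norm_natCast] at h_sum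
  rw [le_div_iff₀ hT, mul_comm]
  refine le_of_mul_le_mul_left ?_ hT
  calc _ = ((T + 1 : ℕ) * ‖expectVec φ X‖) ^ 2 := by ring
    _ ≤ ‖∑ t ∈ range (T + 1), evolve U t X‖ ^ 2 := by gcongr
    _ ≤ _ := norm_sum_evolve_sq_le U hc

end Expectation

section TranslationExpectation

lemma two_pow_le_sqrt_sqrt {N T : ℕ} (hT : 16 ^ T ≤ N) : (2 : ℝ) ^ T ≤ √√N := by
  refine Real.le_sqrt_of_sq_le (Real.le_sqrt_of_sq_le ?_)
  calc ((2 ^ T) ^ 2 : ℝ) ^ 2 = (16 : ℝ) ^ T := by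
        rw [← pow_mul, ← pow_mul, mul_comm, pow_mul]
        norm_num
    _ ≤ N := by exact_mod_cast hT

lemma sum_range_three_quarters_pow_succ_le (T : ℕ) : ∑ j ∈ range T, (3 / 4 : ℝ) ^ (j + 1) ≤ 3 := by
  simp only [pow_succ, ← sum_mul]
  rw [geom_sum_eq (by norm_num)]
  have : 0 < (3 / 4 : ℝ) ^ T := by positivity
  norm_num
  linarith

lemma sum_range_two_pow_succ_le (T : ℕ) : ∑ j ∈ range T, (2 : ℝ) ^ (j + 1) ≤ 2 * 2 ^ T := by
  simp only [pow_succ, ← sum_mul]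
  rw [geom_sum_eq (by norm_num)]
  linarith

lemma succ_le_freqSize {N T : ℕ} (hT : 16 ^ T ≤ N) {k : ℤ × ℤ}
    (hk : N ≤ |k.1| ∨ N ≤ |k.2| * 2 ^ T) : (T + 1 : ℕ) ≤ freqSize k := by
  have hN : (2 ^ T * 2 ^ T : ℤ) ≤ N := by
    rw [← mul_pow]
    calc (2 * 2 : ℤ) ^ T ≤ 16 ^ T := by gcongr; norm_num
      _ ≤ N := by exact_mod_cast hT
  have h_pow : (T : ℤ) ≤ 2 ^ T := by exact_mod_cast (Nat.lt_two_pow_self (n := T)).le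
  have h_one : (1 : ℤ) ≤ 2 ^ T := one_le_pow₀ (by norm_num)
  have h_abs : (T : ℤ) ≤ |k.1| + |k.2| := by
    rcases hk with hk | hk
    · nlinarith [abs_nonneg k.2]
    · have : (2 ^ T : ℤ) ≤ |k.2| := le_of_mul_le_mul_right (hN.trans hk) (by positivity)
      linarith [abs_nonneg k.1]
  have h_real : (T : ℝ) ≤ |(k.1 : ℝ)| + |(k.2 : ℝ)| := by exact_mod_cast h_abs
  rw [freqSize]
  push_cast
  linarith

variable {M : ℕ} [NeZero M]

lemma norm_expectVec_translation_sq_le_of_lt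
    {φ : OrthonormalBasis (Fin (M + M)) ℂ (StateSpace (M + M))} (hφ : IsBakerEigenbasis φ) {T : ℕ}
    (hT : 16 ^ T ≤ M + M) {k : ℤ × ℤ} (hk : k ≠ 0) (hk₁ : |k.1| < (M + M : ℕ))
    (hk₂ : |k.2| * 2 ^ T < (M + M : ℕ)) :
    ‖expectVec φ (translation (M + M) k)‖ ^ 2 ≤
      ((M + M : ℕ) + 234 * freqSize k * (M + M : ℕ)) / (T + 1 : ℕ) := by
  set N := M + M
  set X := translation N k
  have h_size := zero_le_one.trans (one_le_freqSize k)
  have h_decay : ∀ r ≤ T, ‖(Xᴴ * evolve (baker M) r X).trace‖ ≤ if r = 0 then (N : ℝ) else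
      √N * freqSize k * (7 * (3 / 4) ^ r * √N + 48 * 2 ^ r * √√N) := by
    intro r hr
    split_ifs with hr₀
    · rw [hr₀, evolve_zero, ← frobenius_norm_sq_eq_trace, RCLike.norm_ofReal,
        abs_of_nonneg (sq_nonneg _)]
      exact (pow_le_pow_left₀ (norm_nonneg _) (norm_translation_le k) 2).trans_eq
        (Real.sq_sqrt N.cast_nonneg)
    · refine norm_trace_translation_mul_evolve_le hk hr₀ hk₁ (lt_of_le_of_lt ?_ hk₂)
      gcongr
      norm_num
  refine (norm_expectVec_sq_le (U := baker M) hφ h_decay).trans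
    (div_le_div_of_nonneg_right (add_le_add (if_pos rfl).le ?_) (Nat.cast_nonneg _))
  simp only [Nat.add_eq_zero_iff, one_ne_zero, and_false, if_false]
  calc 2 * ∑ j ∈ range T, √N * freqSize k * (7 * (3 / 4) ^ (j + 1) * √N + 48 * 2 ^ (j + 1) * √√N)
      = √N * freqSize k * (14 * √N * ∑ j ∈ range T, (3 / 4 : ℝ) ^ (j + 1) +
          96 * √√N * ∑ j ∈ range T, (2 : ℝ) ^ (j + 1)) := by
        simp only [mul_sum, ← sum_add_distrib]
        exact sum_congr rfl fun j _ => by ring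
    _ ≤ √N * freqSize k * (14 * √N * 3 + 96 * √√N * (2 * √√N)) := by
        gcongr
        · exact sum_range_three_quarters_pow_succ_le T
        · exact (sum_range_two_pow_succ_le T).trans
            (mul_le_mul_of_nonneg_left (two_pow_le_sqrt_sqrt hT) zero_le_two)
    _ = 234 * freqSize k * (√N * √N) := by
        linear_combination 192 * √N * freqSize k * Real.mul_self_sqrt (Real.sqrt_nonneg (N : ℝ))
    _ = 234 * freqSize k * N := by rw [Real.mul_self_sqrt N.cast_nonneg]

lemma norm_expectVec_translation_sq_le
    {φ : OrthonormalBasis (Fin (M + M)) ℂ (StateSpace (M + M))} (hφ : IsBakerEigenbasis φ) {T : ℕ}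
    (hT : 16 ^ T ≤ M + M) {k : ℤ × ℤ} (hk : k ≠ 0) :
    ‖expectVec φ (translation (M + M) k)‖ ^ 2 ≤
      235 * freqSize k * (M + M : ℕ) / (T + 1 : ℕ) := by
  have hN : (0 : ℝ) ≤ (M + M : ℕ) := Nat.cast_nonneg _
  have h_size := one_le_freqSize k
  by_cases h : |k.1| < (M + M : ℕ) ∧ |k.2| * 2 ^ T < (M + M : ℕ)
  · refine (norm_expectVec_translation_sq_le_of_lt hφ hT hk h.1 h.2).trans ?_
    gcongr
    nlinarith
  · rw [not_and_or, not_lt, not_lt] at h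
    have h_time := succ_le_freqSize hT h
    calc ‖expectVec φ (translation (M + M) k)‖ ^ 2 ≤ √((M + M : ℕ) : ℝ) ^ 2 := by
          gcongr
          exact (norm_expectVec_le φ _).trans (norm_translation_le k)
      _ = ((M + M : ℕ) : ℝ) := Real.sq_sqrt hN
      _ ≤ 235 * freqSize k * (M + M : ℕ) / (T + 1 : ℕ) := by
          rw [le_div_iff₀ (by positivity), mul_comm]
          gcongr
          linarith

end TranslationExpectation

end BakerMap

end

noncomputable section

namespace BakerMap

section TorusMean

open MeasureTheory Set

variable {a : ℝ × ℝ → ℂ}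

lemma norm_torusMean_le {C : ℝ} (h : ∀ q ∈ Icc (0 : ℝ) 1, ∀ p ∈ Icc (0 : ℝ) 1, ‖a (q, p)‖ ≤ C) :
    ‖torusMean a‖ ≤ C := by
  have h_sub : uIoc (0 : ℝ) 1 ⊆ Icc 0 1 := by
    rw [uIoc_of_le zero_le_one]
    exact Ioc_subset_Icc_self
  have h_inner {q : ℝ} (hq : q ∈ uIoc (0 : ℝ) 1) : ‖∫ p in (0 : ℝ)..1, a (q, p)‖ ≤ C := by
    simpa using intervalIntegral.norm_integral_le_of_norm_le_const fun p hp =>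
      h q (h_sub hq) p (h_sub hp)
  simpa [torusMean] using intervalIntegral.norm_integral_le_of_norm_le_const @h_inner

lemma integrableOn_unitSquare (ha : Continuous a) : IntegrableOn a (Icc 0 1 ×ˢ Icc 0 1) :=
  ha.continuousOn.integrableOn_compact (isCompact_Icc.prod isCompact_Icc)

lemma torusMean_swap (ha : Continuous a) : torusMean (fun x => a x.swap) = torusMean a := by
  have h_int : Integrable (Function.uncurry fun q p => a (p, q))
      ((volume.restrict (Ioc 0 1)).prod (volume.restrict (Ioc 0 1))) := by
    rw [Measure.prod_restrict]
    exact (integrableOn_unitSquare (ha.comp continuous_swap)).mono_set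
      (prod_mono Ioc_subset_Icc_self Ioc_subset_Icc_self)
  simp only [torusMean, intervalIntegral.integral_of_le (zero_le_one (α := ℝ))]
  exact integral_integral_swap h_int

lemma torusMean_const_mul (c : ℂ) : torusMean (fun x => c * a x) = c * torusMean a := by
  simp only [torusMean, intervalIntegral.integral_const_mul]

end TorusMean

section FourierCoefficient

variable {a : ℝ × ℝ → ℂ}

/-- The conjugate plane wave `e^{-2πi (q k₂ - p k₁)}` against which the Fourier coefficients are
computed. -/
def conjPlaneWave (k : ℤ × ℤ) (x : ℝ × ℝ) : ℂ :=
  Complex.exp (-(2 * Real.pi * Complex.I * (x.1 * k.2 - x.2 * k.1)))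

lemma fourierCoefficient_eq (a : ℝ × ℝ → ℂ) (k : ℤ × ℤ) :
    fourierCoefficient a k = torusMean fun x => a x * conjPlaneWave k x := rfl

lemma norm_conjPlaneWave (k : ℤ × ℤ) (x : ℝ × ℝ) : ‖conjPlaneWave k x‖ = 1 := by
  have h_arg : (-(2 * Real.pi * Complex.I * (x.1 * k.2 - x.2 * k.1)) : ℂ) =
      ((-(2 * Real.pi * (x.1 * k.2 - x.2 * k.1)) : ℝ) : ℂ) * Complex.I := by
    push_cast
    ring
  rw [conjPlaneWave, h_arg, Complex.norm_exp_ofReal_mul_I]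

lemma continuous_conjPlaneWave (k : ℤ × ℤ) : Continuous (conjPlaneWave k) := by
  unfold conjPlaneWave
  fun_prop

lemma conjPlaneWave_one_right (k : ℤ × ℤ) (q : ℝ) :
    conjPlaneWave k (q, 1) = conjPlaneWave k (q, 0) := by
  rw [conjPlaneWave, conjPlaneWave, Complex.exp_eq_exp_iff_exists_int]
  refine ⟨k.1, ?_⟩
  push_cast
  ring

lemma conjPlaneWave_swap (k : ℤ × ℤ) (x : ℝ × ℝ) :
    conjPlaneWave (-k.2, -k.1) x.swap = conjPlaneWave k x := by
  simp only [conjPlaneWave, Prod.fst_swap, Prod.snd_swap]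
  congr 1
  push_cast
  ring

lemma hasDerivAt_conjPlaneWave (k : ℤ × ℤ) (q p : ℝ) :
    HasDerivAt (fun p => conjPlaneWave k (q, p))
      (2 * Real.pi * Complex.I * k.1 * conjPlaneWave k (q, p)) p := by
  have h_arg : HasDerivAt (fun p : ℝ => -(2 * Real.pi * Complex.I * (q * k.2 - (p : ℂ) * k.1)))
      (2 * Real.pi * Complex.I * k.1) p := by
    refine ((((hasDerivAt_id (p : ℂ)).mul_const (k.1 : ℂ)).const_sub
      ((q : ℂ) * k.2)).const_mul (2 * Real.pi * Complex.I : ℂ)).neg.comp_ofReal.congr_deriv ?_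
    ring
  exact h_arg.cexp.congr_deriv (mul_comm _ _)

lemma fourierCoefficient_zero (a : ℝ × ℝ → ℂ) : fourierCoefficient a 0 = torusMean a := by
  simp [fourierCoefficient]

lemma fourierCoefficient_swap (ha : Continuous a) (k : ℤ × ℤ) :
    fourierCoefficient (fun x => a x.swap) k = fourierCoefficient a (-k.2, -k.1) := by
  have h_swap := torusMean_swap (ha.mul (continuous_conjPlaneWave (-k.2, -k.1)))
  simp only [Pi.mul_apply, conjPlaneWave_swap] at h_swap
  exact h_swap

lemma exists_norm_fourierCoefficient_le (ha : Continuous a) :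
    ∃ C, ∀ k, ‖fourierCoefficient a k‖ ≤ C := by
  obtain ⟨C, hC⟩ := ((isCompact_Icc (a := (0 : ℝ)) (b := 1)).prod
    (isCompact_Icc (a := (0 : ℝ)) (b := 1))).exists_bound_of_continuousOn ha.continuousOn
  refine ⟨C, fun k => norm_torusMean_le fun q hq p hp => ?_⟩
  exact (norm_mul_le_of_le (hC (q, p) ⟨hq, hp⟩) (norm_conjPlaneWave k (q, p)).le).trans_eq
    (mul_one C)

/-- The partial derivative `∂a/∂p`, in the momentum variable. -/
def derivP (a : ℝ × ℝ → ℂ) (x : ℝ × ℝ) : ℂ := fderiv ℝ a x (0, 1)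

lemma hasDerivAt_derivP (ha : Differentiable ℝ a) (q p : ℝ) :
    HasDerivAt (fun p => a (q, p)) (derivP a (q, p)) p :=
  (ha (q, p)).hasFDerivAt.comp_hasDerivAt p ((hasDerivAt_const p q).prodMk (hasDerivAt_id p))

lemma fourierCoefficient_derivP (ha : ContDiff ℝ 1 a) (h_per : ∀ q, a (q, 1) = a (q, 0))
    (k : ℤ × ℤ) :
    fourierCoefficient (derivP a) k =
      -(2 * Real.pi * Complex.I * k.1) * fourierCoefficient a k := by
  have h_line (q : ℝ) : Continuous fun p : ℝ => (q, p) := by fun_prop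
  have h_wave (q : ℝ) :
      Continuous fun p => 2 * Real.pi * Complex.I * k.1 * conjPlaneWave k (q, p) :=
    continuous_const.mul ((continuous_conjPlaneWave k).comp (h_line q))
  have h_deriv (q : ℝ) : Continuous fun p => derivP a (q, p) :=
    ((ha.continuous_fderiv one_ne_zero).clm_apply continuous_const).comp (h_line q)
  rw [fourierCoefficient_eq, fourierCoefficient_eq, ← torusMean_const_mul, torusMean, torusMean]
  refine intervalIntegral.integral_congr fun q _ => ?_
  have h_parts := intervalIntegral.integral_mul_deriv_eq_deriv_mul (a := 0) (b := 1)
    (fun p _ => hasDerivAt_derivP (ha.differentiable one_ne_zero) q p)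
    (fun p _ => hasDerivAt_conjPlaneWave k q p)
    ((h_deriv q).intervalIntegrable _ _) ((h_wave q).intervalIntegrable _ _)
  rw [conjPlaneWave_one_right, h_per, sub_self, zero_sub] at h_parts
  rw [← neg_eq_iff_eq_neg.2 h_parts, ← intervalIntegral.integral_neg]
  refine intervalIntegral.integral_congr fun p _ => ?_
  ring

end FourierCoefficient

section Decay

variable {a : ℝ × ℝ → ℂ}

lemma IsSmoothObservable.swap (ha : IsSmoothObservable a) : IsSmoothObservable fun x => a x.swap :=
  ⟨ha.contDiff.comp (contDiff_snd.prodMk contDiff_fst), fun q p => ha.periodic_p p q,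
    fun q p => ha.periodic_q p q⟩

lemma derivP_add_eq_of_periodic {v : ℝ × ℝ} (hv : ∀ x, a (x + v) = a x) (x : ℝ × ℝ) :
    derivP a (x + v) = derivP a x := by
  rw [derivP, derivP, ← fderiv_comp_add_right, funext hv]

lemma IsSmoothObservable.derivP (ha : IsSmoothObservable a) : IsSmoothObservable (derivP a) where
  contDiff := (ha.contDiff.fderiv_right (m := ∞) (by simp)).clm_apply contDiff_const
  periodic_q q p := by
    simpa using derivP_add_eq_of_periodic (v := (1, 0))
      (fun ⟨q, p⟩ => by simpa using ha.periodic_q q p) (q, p)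
  periodic_p q p := by
    simpa using derivP_add_eq_of_periodic (v := (0, 1))
      (fun ⟨q, p⟩ => by simpa using ha.periodic_p q p) (q, p)

lemma IsSmoothObservable.fourierCoefficient_derivP (ha : IsSmoothObservable a) (k : ℤ × ℤ) :
    fourierCoefficient (BakerMap.derivP a) k =
      -(2 * Real.pi * Complex.I * k.1) * fourierCoefficient a k :=
  BakerMap.fourierCoefficient_derivP (ha.contDiff.of_le (by simp))
    (fun q => by simpa using ha.periodic_p q 0) k

lemma IsSmoothObservable.sq_fst_mul_norm_fourierCoefficient_le (ha : IsSmoothObservable a)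
    (k : ℤ × ℤ) : (k.1 : ℝ) ^ 2 * ‖fourierCoefficient a k‖ ≤
      ‖fourierCoefficient (BakerMap.derivP (BakerMap.derivP a)) k‖ := by
  rw [ha.derivP.fourierCoefficient_derivP, ha.fourierCoefficient_derivP, ← mul_assoc, norm_mul]
  gcongr
  simp only [norm_mul, norm_neg, Complex.norm_I, Complex.norm_real, Complex.norm_intCast,
    Complex.norm_ofNat, mul_one, Real.norm_of_nonneg Real.pi_pos.le]
  rw [← sq, mul_pow, sq_abs]
  exact le_mul_of_one_le_left (sq_nonneg _) (one_le_pow₀ (by linarith [Real.two_le_pi]))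

/-- The weight `w` on the frequencies bounds the decay of the Fourier coefficients of every smooth
observable `a`, in that `w k * |ã(k)|` is bounded. Quantifying over `a` lets the weights be
multiplied, by passing to derivatives. -/
def IsDecayWeight (w : ℤ × ℤ → ℝ) : Prop :=
  ∀ a, IsSmoothObservable a → ∃ C, ∀ k, w k * ‖fourierCoefficient a k‖ ≤ C

lemma isDecayWeight_one : IsDecayWeight 1 := fun a ha => by
  simpa using exists_norm_fourierCoefficient_le ha.contDiff.continuous

lemma IsDecayWeight.swap {w : ℤ × ℤ → ℝ} (hw : IsDecayWeight w) :
    IsDecayWeight fun k => w (-k.2, -k.1) := by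
  intro a ha
  obtain ⟨C, hC⟩ := hw _ ha.swap
  refine ⟨C, fun k => ?_⟩
  simpa [fourierCoefficient_swap ha.contDiff.continuous] using hC (-k.2, -k.1)

lemma IsDecayWeight.one_add_sq_fst_mul {w : ℤ × ℤ → ℝ} (hw : IsDecayWeight w) (hw₀ : 0 ≤ w) :
    IsDecayWeight fun k => (1 + (k.1 : ℝ) ^ 2) * w k := by
  intro a ha
  obtain ⟨C, hC⟩ := hw a ha
  obtain ⟨D, hD⟩ := hw _ ha.derivP.derivP
  refine ⟨C + D, fun k => ?_⟩
  linarith [hC k, hD k,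
    mul_le_mul_of_nonneg_left (ha.sq_fst_mul_norm_fourierCoefficient_le k) (hw₀ k)]

lemma isDecayWeight_mul : IsDecayWeight fun k =>
    (1 + (k.1 : ℝ) ^ 2) ^ 2 * (1 + (k.2 : ℝ) ^ 2) ^ 2 := by
  have h := (((isDecayWeight_one.one_add_sq_fst_mul zero_le_one).one_add_sq_fst_mul
    fun k => by simp only [Pi.zero_apply, Pi.one_apply]; positivity).swap.one_add_sq_fst_mul
      fun k => by simp only [Pi.zero_apply, Pi.one_apply]; positivity).one_add_sq_fst_mul
        fun k => by simp only [Pi.zero_apply, Pi.one_apply]; positivity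
  convert h using 2 with k
  simp only [Pi.one_apply]
  push_cast
  ring

lemma summable_one_div_one_add_sq : Summable fun m : ℤ => 1 / (1 + (m : ℝ) ^ 2) := by
  refine (Real.summable_one_div_int_pow.2 one_lt_two).of_norm_bounded_eventually ?_
  filter_upwards [(Set.finite_singleton (0 : ℤ)).eventually_cofinite_notMem] with m hm
  rw [Set.mem_singleton_iff] at hm
  rw [Real.norm_of_nonneg (by positivity)]
  gcongr
  exact le_add_of_nonneg_left zero_le_one

lemma sqrt_freqSize_le (k : ℤ × ℤ) :
    √(freqSize k) ≤ 2 * ((1 + (k.1 : ℝ) ^ 2) * (1 + (k.2 : ℝ) ^ 2)) := by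
  refine (Real.sqrt_le_self_iff.2 (Or.inr (one_le_freqSize k))).trans ?_
  rw [freqSize]
  nlinarith [sq_nonneg (|(k.1 : ℝ)| - 1), sq_nonneg (|(k.2 : ℝ)| - 1), sq_abs (k.1 : ℝ),
    sq_abs (k.2 : ℝ), sq_nonneg ((k.1 : ℝ) * k.2)]

lemma IsSmoothObservable.summable_sqrt_freqSize_mul (ha : IsSmoothObservable a) :
    Summable fun k => √(freqSize k) * ‖fourierCoefficient a k‖ := by
  obtain ⟨C, hC⟩ := isDecayWeight_mul a ha
  refine Summable.of_nonneg_of_le (fun k => by positivity) (fun k => ?_)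
    ((summable_one_div_one_add_sq.mul_of_nonneg summable_one_div_one_add_sq
      (fun m => by positivity) (fun m => by positivity)).mul_left (2 * C))
  calc √(freqSize k) * ‖fourierCoefficient a k‖
      ≤ 2 * ((1 + (k.1 : ℝ) ^ 2) * (1 + (k.2 : ℝ) ^ 2)) * ‖fourierCoefficient a k‖ := by
        gcongr
        exact sqrt_freqSize_le k
    _ = 2 * ((1 + (k.1 : ℝ) ^ 2) ^ 2 * (1 + (k.2 : ℝ) ^ 2) ^ 2 * ‖fourierCoefficient a k‖) *
        (1 / (1 + (k.1 : ℝ) ^ 2) * (1 / (1 + (k.2 : ℝ) ^ 2))) := by field_simp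
    _ ≤ 2 * C * (1 / (1 + (k.1 : ℝ) ^ 2) * (1 / (1 + (k.2 : ℝ) ^ 2))) := by
        gcongr
        exact hC k

end Decay

section Weyl

variable {N : ℕ} {a : ℝ × ℝ → ℂ}

/-- An integrable function on the torus, given on the fundamental domain `[0, 1]²`, whose Fourier
coefficients are summable against the weight `√(1 + |k₁| + |k₂|)`: the regularity on which the
variance estimate depends. Integrability excludes junk values of the Fourier coefficients. -/
structure IsWienerObservable (a : ℝ × ℝ → ℂ) : Prop where
  integrableOn : MeasureTheory.IntegrableOn a (Set.Icc 0 1 ×ˢ Set.Icc 0 1)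
  summable : Summable fun k => √(freqSize k) * ‖fourierCoefficient a k‖

lemma IsSmoothObservable.isWienerObservable (ha : IsSmoothObservable a) : IsWienerObservable a where
  integrableOn := integrableOn_unitSquare ha.contDiff.continuous
  summable := ha.summable_sqrt_freqSize_mul

lemma norm_translation_apply_le (k : ℤ × ℤ) (i j : Fin N) : ‖translation N k i j‖ ≤ 1 := by
  have : NeZero N := ⟨i.pos.ne'⟩
  rw [translation_eq, Matrix.diagonal_mul, norm_mul, sample, norm_wave, one_mul,
    momentumOp_wave_apply]
  split_ifs <;> simp

lemma translation_zero (N : ℕ) : translation N 0 = 1 := by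
  ext i j
  rw [translation, Matrix.of_apply, Matrix.one_apply]
  have h_iff : ((i : ℕ) : ℤ) ≡ ((j : ℕ) : ℤ) + (0 : ℤ × ℤ).1 [ZMOD (N : ℤ)] ↔ i = j := by
    rw [Prod.fst_zero, add_zero, Int.natCast_modEq_iff, Nat.ModEq, Nat.mod_eq_of_lt i.2,
      Nat.mod_eq_of_lt j.2, Fin.ext_iff]
  simp only [h_iff]
  split_ifs <;> simp

lemma IsWienerObservable.summable_weyl (ha : IsWienerObservable a) (N : ℕ) :
    Summable fun k => fourierCoefficient a k • translation N k := by
  refine Pi.summable.2 fun i => Pi.summable.2 fun j => ha.summable.of_norm_bounded fun k => ?_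
  rw [Matrix.smul_apply, smul_eq_mul, norm_mul, mul_comm]
  gcongr
  exact (norm_translation_apply_le k i j).trans (Real.one_le_sqrt.2 (one_le_freqSize k))

lemma quantumVariance_eq (φ : OrthonormalBasis (Fin N) ℂ (StateSpace N)) (a : ℝ × ℝ → ℂ) :
    quantumVariance φ a =
      1 / N * ‖expectVec φ (weyl N a) - torusMean a • expectVec φ 1‖ ^ 2 := by
  rw [quantumVariance, EuclideanSpace.norm_sq_eq]
  congr 1
  refine Finset.sum_congr rfl fun j _ => ?_
  rw [PiLp.sub_apply, PiLp.smul_apply, expectVec_apply, expectVec_apply, op_one_apply,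
    inner_self_eq_norm_sq_to_K, φ.norm_eq_one]
  simp

lemma norm_expectVec_weyl_sub_le (ha : IsWienerObservable a)
    {φ : OrthonormalBasis (Fin N) ℂ (StateSpace N)} {R : ℝ}
    (hR : ∀ k ≠ 0, ‖expectVec φ (translation N k)‖ ≤ R * √(freqSize k)) (hR₀ : 0 ≤ R) :
    ‖expectVec φ (weyl N a) - torusMean a • expectVec φ 1‖ ≤
      R * ∑' k, √(freqSize k) * ‖fourierCoefficient a k‖ := by
  have h_sum : HasSum (fun k => expectVec φ (fourierCoefficient a k • translation N k))
      (expectVec φ (weyl N a)) :=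
    (ha.summable_weyl N).hasSum.map (expectVec φ) (LinearMap.continuous_of_finiteDimensional _)
  have h_diff := h_sum.sub (hasSum_ite_eq (0 : ℤ × ℤ) (torusMean a • expectVec φ 1))
  refine h_diff.norm_le_of_bounded (ha.summable.hasSum.mul_left R) fun k => ?_
  rw [map_smul]
  split_ifs with hk
  · rw [hk, fourierCoefficient_zero, translation_zero, sub_self, norm_zero]
    positivity
  · rw [sub_zero, norm_smul, mul_comm, ← mul_assoc]
    gcongr
    exact hR k hk

lemma exists_log_time {N : ℕ} (hN : N ≠ 0) :
    ∃ T : ℕ, 16 ^ T ≤ N ∧ Real.log N ≤ 3 * (T + 1 : ℕ) := by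
  refine ⟨Nat.log 16 N, Nat.pow_log_le_self 16 hN, ?_⟩
  have h_lt : (N : ℝ) ≤ 16 ^ (Nat.log 16 N + 1) := by
    exact_mod_cast (Nat.lt_pow_succ_log_self (by norm_num) N).le
  have h_log : Real.log 16 ≤ 3 := by
    rw [show (16 : ℝ) = 2 ^ 4 by norm_num, Real.log_pow]
    push_cast
    linarith [Real.log_two_lt_d9]
  calc Real.log N ≤ Real.log (16 ^ (Nat.log 16 N + 1)) := by gcongr
    _ = (Nat.log 16 N + 1 : ℕ) * Real.log 16 := Real.log_pow _ _
    _ ≤ 3 * (Nat.log 16 N + 1 : ℕ) := by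
        rw [mul_comm]
        gcongr

lemma quantumVariance_le (ha : IsWienerObservable a) {M : ℕ} [NeZero M]
    {φ : OrthonormalBasis (Fin (M + M)) ℂ (StateSpace (M + M))} (hφ : IsBakerEigenbasis φ) :
    quantumVariance φ a ≤
      705 * (∑' k, √(freqSize k) * ‖fourierCoefficient a k‖) ^ 2 / Real.log (M + M : ℕ) := by
  have hM := NeZero.pos M
  have h_log : 0 < Real.log (M + M : ℕ) := Real.log_pos (by exact_mod_cast (by lia : 1 < M + M))
  obtain ⟨T, hT, h_time⟩ := exists_log_time (N := M + M) (by lia)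
  set S := ∑' k, √(freqSize k) * ‖fourierCoefficient a k‖
  have h_norm : ‖expectVec φ (weyl (M + M) a) - torusMean a • expectVec φ 1‖ ≤
      √(235 * (M + M : ℕ) / (T + 1 : ℕ)) * S := by
    refine norm_expectVec_weyl_sub_le ha (fun k hk => ?_) (Real.sqrt_nonneg _)
    rw [← Real.sqrt_mul (by positivity)]
    exact Real.le_sqrt_of_sq_le
      ((norm_expectVec_translation_sq_le hφ hT hk).trans_eq (by ring))
  rw [quantumVariance_eq]
  calc _ ≤ 1 / ((M + M : ℕ) : ℝ) * (√(235 * (M + M : ℕ) / (T + 1 : ℕ)) * S) ^ 2 := by gcongr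
    _ = 705 * S ^ 2 / (3 * (T + 1 : ℕ)) := by
        rw [mul_pow, Real.sq_sqrt (by positivity)]
        field_simp
        ring
    _ ≤ 705 * S ^ 2 / Real.log (M + M : ℕ) := by gcongr

end Weyl

end BakerMap

end

theorem theorem1_general (a : ℝ × ℝ → ℂ) (ha : BakerMap.IsWienerObservable a) :
    (∀ N : ℕ, Summable fun k : ℤ × ℤ =>
      BakerMap.fourierCoefficient a k • BakerMap.translation N k) ∧
    ∃ C : ℝ, ∀ N : ℕ, 0 < N → Even N →
      ∀ φ : OrthonormalBasis (Fin N) ℂ (BakerMap.StateSpace N),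
        BakerMap.IsBakerEigenbasis φ →
          BakerMap.quantumVariance φ a ≤ C / Real.log N := by
  refine ⟨ha.summable_weyl, 705 * (∑' k, √(BakerMap.freqSize k) *
    ‖BakerMap.fourierCoefficient a k‖) ^ 2, ?_⟩
  rintro N hN ⟨M, rfl⟩ φ hφ
  have : NeZero M := ⟨by lia⟩
  exact BakerMap.quantumVariance_le ha hφ

theorem theorem1 (a : ℝ × ℝ → ℂ) (ha : BakerMap.IsSmoothObservable a) :
    (∀ N : ℕ, Summable fun k : ℤ × ℤ =>
      BakerMap.fourierCoefficient a k • BakerMap.translation N k) ∧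
    ∃ C : ℝ, ∀ N : ℕ, 0 < N → Even N →
      ∀ φ : OrthonormalBasis (Fin N) ℂ (BakerMap.StateSpace N),
        BakerMap.IsBakerEigenbasis φ →
          BakerMap.quantumVariance φ a ≤ C / Real.log N := by
  exact theorem1_general a ha.isWienerObservable
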